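/- **Setting.** Let $\mathbf G=(V,G)$ be a finite connected undirected graph with diameter $\Delta$. Variables range over $V$, except number variables $p,q$, which range over $\mathbb N$. *Datalog$^\neg$.* A program $P_{DL}$ is a finite set of rules $\gamma_0 :- \gamma_1;\dots;\gamma_l$ ($l\ge 0$), where $\gamma_0=R(\vec x)$ for a relation name $R$ of arity at least $1$ and every $\gamma_j$ is an atom $G(x,y)$, $x=y$, $R(\vec x)$ or a negated such atom. Relations in heads are *intensional*. $\Psi_{P}(I)$ is the set of the facts $\sigma(\gamma_0)$ for rules of $P$ and valuations $\sigma$ into $V$ under which the body holds in $I\cup G$. The stages are $I_{DL,0}=\emptyset$, $I_{DL,i+1}=\Psi_{P_{DL}}(I_{DL,i})\cup I_{DL,i}$. *Netlog.* Each atom has a holding variable, written $@x$; a fact is stored on the node that interprets it, and $I_v$ is the set of the facts of $I$ stored on $v$. A program is a finite set of rules $(\uparrow)\gamma_0:-\gamma_1;\dots;\gamma_l$ (bodies may also contain comparisons of nodes or numbers, which have no holding variable) such that (i) all body literals have the same holding variable $y$; (ii) the head is pushed ($\uparrow$) exactly if its holding variable $x$ is not $y$; (iii) if it is pushed, $G(@y,x)$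 is in the body. $\Psi_P(I)$ is the set of the facts $\sigma(\gamma_0)$ for rules of $P$ and valuations $\sigma$ under which the body holds in $I_{\sigma(y)}\cup G$. The stages of $P_{NL}$ are $I_{NL,0}=\{start(v): v\in V\}$, $I_{NL,j+1}=\Psi_{P_{NL}}(I_{NL,j})$. A computation *terminates* if its sequence of stages is eventually constant; its eventual value is denoted $P(\mathbf G)$. **Rewriting algorithm.** The holding variable of an atom of $P_{DL}$ is its leftmost variable; $G(@x,y)$ and $G(@y,x)$ are not distinguished, so $G(x,y)$ can be held at $x$ or at $y$. *Distribution.* For each rule $r$ with head held at $h$, compute $(T_r,\kappa_r)=\mathrm{Rewrite}(r,h,\{h\})$. Here $\mathrm{Rewrite}(r,h,CN)$ is as follows. Let $S'$ be the set of the body literals that can be held at $h$ and $S''$ the set of the others. If $S''=\emptyset$, then $T_r=\{r\}$, evaluated at $h$, and $\kappa_r=1$. Otherwise let $S''_1,\dots,S''_n$ be the connected components of $S''$ for the relation "having a common variable outside $CN$". For each $i$ take a new relation name $Q_i$ and let $T_i$ be the set of the holding variables $v$ of literals of $S''_i$ with $G(@h,v)\in S'$. - If $T_i\ne\emptyset$,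 choose any $h_i\in T_i$, add $G(@h_i,h)$ to $S''_i$, let $d_i=1$ and $r_i: Q_i(\vec y_i):-S''_i$, where $\vec y_i$ lists $var(S''_i)\cap(var(S')\cup var(head_r))$, with $h$ as holding variable. - If $T_i=\emptyset$, choose any holding variable $h_i$ of a literal of $S''_i$, let $d_i=1+\Delta$ and $r_i: Q_i(@h_i,\vec y_i):-S''_i$ with $\vec y_i$ as before (the holding attribute is an additional one), and add the rule $r_i': Q_i(@x,\vec z):-Q_i(@y,\vec z);G(@y,x)$. Then $T_r$ consists of the rule $head_r:-S';Q_1;\dots;Q_n$, in which each $Q_i$ is held at $h$ (that is, $Q_i(\vec y_i)$ in the first case and $Q_i(@h,\vec y_i)$ in the second), of the rules $r_i'$, and of the $T_{r_i}$ with $(T_{r_i},\kappa_{r_i})=\mathrm{Rewrite}(r_i,h_i,CN\cup\{h_i\})$; and $\kappa_r=\max_i(\kappa_{r_i}+d_i)$. Put $\kappa=\max\{\Delta,\max_r\kappa_r\}$. *Communication and clocks.* Put $\uparrow$ before each head whose holding variable is not that of its body; add $clock(@x,q);q\ne0$ to each body, $x$ being its holding variable; replace each intensional $R$ in a head by $tempR$.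 For each intensional $R$ add, with $x$ the holding variable of $R(\vec x)$, - $R(\vec x):-tempR(\vec x);clock(@x,0)$, - $continue(@x):-tempR(\vec x);\neg R(\vec x);clock(@x,0)$, - $\uparrow inf(@y,x):-tempR(\vec x);\neg R(\vec x);clock(@x,0);G(@x,y)$, - $R(\vec x):-R(\vec x)$. For each relation $Q$ that is some $tempR$ or a sub-query $Q_i$ add $Q(@x,\dots):-Q(@x,\dots);clock(@x,q);q\neq0$. Finally add - $continue(@x):-start(@x)$; $\ \uparrow inf(@y,x):-start(@x);G(@x,y)$; $\ clock(@x,\kappa):-start(@x)$; - $clock(@x,p):-clock(@x,q);q\ge1;p=q-1;\neg stop(@x)$; - $clock(@x,\kappa):-clock(@x,0);\neg stop(@x)$; - $\uparrow inf(@z,x):-inf(@y,x);G(@y,z);x\ne z;clock(@y,q);q\ge\theta$; - $continue(@x):-inf(@x,y);clock(@x,q);q\ne0$; - $continue(@x):-continue(@x);clock(@x,q);q\neq0$; - $stop(@x):-\neg continue(@x);clock(@x,0)$, where $\theta$ is any fixed integer with $1\le\theta\le\kappa-\Delta+2$. **Theorem.** For every such $\mathbf G$, every Datalog$^\neg$ program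 $P_{DL}$, all choices in the algorithm and every admissible $\theta$, the output $P_{NL}$ is a Netlog program (its rules satisfy (i)–(iii)), and: 1. the computation of $P_{NL}$ on $\mathbf G$ terminates if and only if the computation of $P_{DL}$ on $\mathbf G$ terminates; 2. when they do, $P_{NL}(\mathbf G)=P_{DL}(\mathbf G)$; 3. for all $i\ge0$, every relation $R$ of $P_{DL}$ and every tuple $\vec c$ of nodes, $R(\vec c)\in I_{DL,i}$ if and only if $R(\vec c)\in I_{NL,\,i(\kappa+1)+1}$. -/

import Mathlib

universe u v

/-- Relation names with their arities. The relation `R` has arity `ar R + 1 ≥ 1`; its first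
(leftmost) attribute is the holding attribute. The edge relation `G` of the graph is not listed
here: it is the only input relation. -/
structure Signature where
  Rel : Type u
  ar : Rel → ℕ

/-- Variables. -/
abbrev Var := ℕ

/-- The sequence of instances `s` converges to `I`. -/
def ConvergesTo {α : Type*} (s : ℕ → Set α) (I : Set α) : Prop :=
  ∃ n, ∀ m, n ≤ m → s m = I

/-- A computation terminates if its sequence of stages converges. -/
def Terminates {α : Type*} (s : ℕ → Set α) : Prop :=
  ∃ I, ConvergesTo s I

/-! ### Datalog with negation, inflationary semantics -/

namespace Datalog

/-- Atoms of rule bodies: `G(x, y)`, `x = y`, `R(x₀, …, xₖ)`. -/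
inductive Atom (S : Signature.{u}) : Type u
  | edge (x y : Var) : Atom S
  | eq (x y : Var) : Atom S
  | rel (R : S.Rel) (args : Fin (S.ar R + 1) → Var) : Atom S

/-- An atom or (`positive = false`) a negated atom. -/
structure Literal (S : Signature.{u}) : Type u where
  positive : Bool
  atom : Atom S

/-- `head(headArgs) :- body`. The body may be empty. -/
structure Rule (S : Signature.{u}) : Type u where
  head : S.Rel
  headArgs : Fin (S.ar head + 1) → Var
  body : List (Literal S)

/-- A program is a finite collection of rules. -/
abbrev Program (S : Signature.{u}) : Type u := List (Rule S)

/-- A ground fact `R(c₀, …, cₖ)`. -/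
structure Fact (S : Signature.{u}) (V : Type v) : Type (max u v) where
  rel : S.Rel
  args : Fin (S.ar rel + 1) → V

variable {S : Signature.{u}} {V : Type v}

def Atom.Holds (G : SimpleGraph V) (I : Set (Fact S V)) (σ : Var → V) : Atom S → Prop
  | .edge x y => G.Adj (σ x) (σ y)
  | .eq x y => σ x = σ y
  | .rel R args => (⟨R, fun i => σ (args i)⟩ : Fact S V) ∈ I

def Literal.Holds (G : SimpleGraph V) (I : Set (Fact S V)) (σ : Var → V) (l : Literal S) : Prop :=
  if l.positive then l.atom.Holds G I σ else ¬ l.atom.Holds G I σ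

/-- The immediate consequence operator. -/
def consequence (P : Program S) (G : SimpleGraph V) (I : Set (Fact S V)) : Set (Fact S V) :=
  {f | ∃ r ∈ P, ∃ σ : Var → V, (∀ l ∈ r.body, l.Holds G I σ) ∧
    f = ⟨r.head, fun i => σ (r.headArgs i)⟩}

/-- The stages of the inflationary computation. -/
def stage (P : Program S) (G : SimpleGraph V) : ℕ → Set (Fact S V)
  | 0 => ∅
  | n + 1 => consequence P G (stage P G n) ∪ stage P G n

/-- The variables of an atom. -/
def Atom.vars : Atom S → List Var
  | .edge x y => [x, y]
  | .eq x y => [x, y]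
  | .rel _ args => List.ofFn args

/-- The variables at which an atom can be held: the leftmost one, and both variables of an edge
atom, since `G(@x, y)` and `G(@y, x)` are not distinguished. -/
def Atom.holders : Atom S → List Var
  | .edge x y => [x, y]
  | .eq x _ => [x]
  | .rel _ args => [args 0]

/-- The literal can be evaluated at the node that interprets `h`. -/
def Literal.localAt (h : Var) (l : Literal S) : Bool := l.atom.holders.contains h

/-- The literal is `G(h, x)`, up to the symmetry of `G`. -/
def Literal.isEdge (h x : Var) (l : Literal S) : Bool :=
  match l.positive, l.atom with
  | true, .edge a b => (a == h && b == x) || (a == x && b == h)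
  | _, _ => false

/-- The variables of a set of literals. -/
def varsOf (C : List (Literal S)) : List Var := C.flatMap fun l => l.atom.vars

/-- The variables at which some literal of a set can be held. -/
def holdersOf (C : List (Literal S)) : List Var := C.flatMap fun l => l.atom.holders

/-- The two literals have a common variable outside `CN`. -/
def Literal.linked (CN : List Var) (l l' : Literal S) : Bool :=
  l.atom.vars.any fun x => l'.atom.vars.contains x && !CN.contains x

/-- Add a literal to a family of connected components: all components that it is linked to are
merged. -/
def insertComponent (CN : List Var) (l : Literal S) (cs : List (List (Literal S))) :
    List (List (Literal S)) :=
  (l :: (cs.filter fun c => c.any (l.linked CN)).flatten) ::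
    cs.filter fun c => !c.any (l.linked CN)

/-- The partition of a set of literals into the minimal parts closed under `linked CN`. -/
def components (CN : List Var) (C : List (Literal S)) : List (List (Literal S)) :=
  C.foldr (insertComponent CN) []

end Datalog

/-! ### Netlog -/

namespace Netlog

/-- Arguments of atoms: node variables, and number variables or number constants. -/
inductive Term : Type
  | node (x : Var) : Term
  | num (q : Var) : Term
  | const (c : ℕ) : Term

/-- The atom `R(@hv, args)`. -/
structure Atom (N : Type u) : Type u where
  rel : N
  hv : Var
  args : List Term

/-- Body literals: `(¬)R(@x, …)`, `(¬)G(@x, y)`, and the built-in comparisons `x = y`, `x ≠ y` of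
nodes and `q ≠ c`, `q ≥ c`, `p = q - 1` of numbers. -/
inductive Literal (N : Type u) : Type u
  | rel (positive : Bool) (a : Atom N) : Literal N
  | edge (positive : Bool) (x y : Var) : Literal N
  | eq (positive : Bool) (x y : Var) : Literal N
  | numNe (q : Var) (c : ℕ) : Literal N
  | numGe (q : Var) (c : ℕ) : Literal N
  | numPred (p q : Var) : Literal N

/-- The rule `(↑) head :- body`; `hv` is the holding variable of the body. -/
structure Rule (N : Type u) : Type u where
  push : Bool
  head : Atom N
  hv : Var
  body : List (Literal N)

abbrev Program (N : Type u) : Type u := List (Rule N)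

/-- The holding variable of a literal; comparisons have none. -/
def Literal.hv? {N : Type u} : Literal N → Option Var
  | .rel _ a => some a.hv
  | .edge _ x _ => some x
  | _ => none

/-- The localization restrictions: all body literals have the same holding variable; the head is
pushed exactly if it is held elsewhere than the body, and then only along an edge. -/
def Rule.Localized {N : Type u} (r : Rule N) : Prop :=
  (∀ l ∈ r.body, ∀ x ∈ l.hv?, x = r.hv) ∧
  (r.push = true ↔ r.head.hv ≠ r.hv) ∧
  (r.push = true → Literal.edge true r.hv r.head.hv ∈ r.body)

/-- A ground fact `R(@holder, args)`, stored on the node `holder`. -/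
structure Fact (N : Type u) (V : Type v) : Type (max u v) where
  rel : N
  holder : V
  args : List (V ⊕ ℕ)

/-- The part `I_v` of an instance that is stored on the node `v`. -/
def fragment {N : Type u} {V : Type v} (I : Set (Fact N V)) (v : V) : Set (Fact N V) :=
  {f ∈ I | f.holder = v}

def Term.eval {V : Type v} (σ : Var → V) (τ : Var → ℕ) : Term → V ⊕ ℕ
  | .node x => .inl (σ x)
  | .num q => .inr (τ q)
  | .const c => .inr c

def Atom.eval {N : Type u} {V : Type v} (σ : Var → V) (τ : Var → ℕ) (a : Atom N) : Fact N V :=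
  ⟨a.rel, σ a.hv, a.args.map (Term.eval σ τ)⟩

/-- Truth of a literal in the local database `J` of a node. -/
def Literal.Holds {N : Type u} {V : Type v} (G : SimpleGraph V) (J : Set (Fact N V))
    (σ : Var → V) (τ : Var → ℕ) : Literal N → Prop
  | .rel b a => if b then a.eval σ τ ∈ J else a.eval σ τ ∉ J
  | .edge b x y => if b then G.Adj (σ x) (σ y) else ¬ G.Adj (σ x) (σ y)
  | .eq b x y => if b then σ x = σ y else σ x ≠ σ y
  | .numNe q c => τ q ≠ c
  | .numGe q c => c ≤ τ q
  | .numPred p q => τ p + 1 = τ q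

/-- The immediate consequence operator: a rule is evaluated on the node that interprets the
holding variable of its body, with the facts stored there. -/
def consequence {N : Type u} {V : Type v} (P : Program N) (G : SimpleGraph V)
    (I : Set (Fact N V)) : Set (Fact N V) :=
  {f | ∃ r ∈ P, ∃ (σ : Var → V) (τ : Var → ℕ),
    (∀ l ∈ r.body, l.Holds G (fragment I (σ r.hv)) σ τ) ∧ f = r.head.eval σ τ}

/-- The stages of the computation with initial instance `I₀`. -/
def stage {N : Type u} {V : Type v} (P : Program N) (G : SimpleGraph V) (I₀ : Set (Fact N V)) :
    ℕ → Set (Fact N V)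
  | 0 => I₀
  | n + 1 => consequence P G (stage P G I₀ n)

/-- The node variables of an atom. -/
def Atom.vars {N : Type u} (a : Atom N) : List Var :=
  a.hv :: a.args.filterMap fun t => match t with
    | .node x => some x
    | _ => none

end Netlog

/-! ### The rewriting algorithm -/

namespace Rewriting

open Netlog

/-- Relation names of the rewritten program: the relations of the Datalog program, their
temporary copies, the sub-queries, and the relations that coordinate the stages. -/
inductive Name (S : Signature.{u}) : Type u
  | base (R : S.Rel) : Name S
  | temp (R : S.Rel) : Name S
  | sub (path : List ℕ) : Name S
  | start : Name S
  | clock : Name S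
  | cont : Name S
  | inf : Name S
  | halt : Name S

/-- The choices left open by the algorithm: for the sub-query with a given name, a member of a
nonempty list of candidate holding variables. -/
structure Choice where
  pick : List ℕ → List Var → Var
  pick_mem : ∀ (path : List ℕ) (l : List Var), l ≠ [] → pick path l ∈ l

variable {S : Signature.{u}}

/-- A literal of the Datalog program, evaluated at `h`; edge atoms are written `G(@h, ·)`. -/
def toNetlog (h : Var) (l : Datalog.Literal S) : Literal (Name S) :=
  match l.atom with
  | .edge x y => if x = h then .edge l.positive x y else .edge l.positive y x
  | .eq x y => .eq l.positive x y
  | .rel R args => .rel l.positive ⟨.base R, args 0, (List.ofFn (Fin.tail args)).map .node⟩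

/-- The part of a body that can be evaluated at `h`. -/
def localPart (h : Var) (body : List (Datalog.Literal S)) : List (Datalog.Literal S) :=
  body.filter fun l => l.localAt h

/-- The part of a body that cannot be evaluated at `h`. -/
def nonlocalPart (h : Var) (body : List (Datalog.Literal S)) : List (Datalog.Literal S) :=
  body.filter fun l => !l.localAt h

/-- The holding variables of literals of `C` that are neighbours of `h` by the local part `L`. -/
def neighbours (h : Var) (L C : List (Datalog.Literal S)) : List Var :=
  (Datalog.holdersOf C).filter fun x => L.any (Datalog.Literal.isEdge h x)

/-- The node variable at which the component `C` is going to be evaluated: a neighbour of `h` if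
there is one, and otherwise the holding variable of any literal of `C`. -/
def subHolder (ch : Choice) (path : List ℕ) (h : Var) (L C : List (Datalog.Literal S)) : Var :=
  if neighbours h L C = [] then ch.pick path (Datalog.holdersOf C)
  else ch.pick path (neighbours h L C)

/-- The body of the sub-query for the component `C`. -/
def subBody (ch : Choice) (path : List ℕ) (h : Var) (L C : List (Datalog.Literal S)) :
    List (Datalog.Literal S) :=
  if neighbours h L C = [] then C
  else ⟨true, .edge (subHolder ch path h L C) h⟩ :: C

/-- The variables that the body `B` of a sub-query shares with the local part or the head. -/
def sharedVars (head : Atom (Name S)) (L B : List (Datalog.Literal S)) : List Var :=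
  ((Datalog.varsOf B).filter fun x =>
    (Datalog.varsOf L).contains x || head.vars.contains x).dedup

/-- The arguments of the sub-query besides the holding one. If the result is pushed directly to
`h`, then the holding variable is the shared variable `h`; otherwise it is an additional one. -/
def subArgs (ch : Choice) (path : List ℕ) (head : Atom (Name S)) (h : Var)
    (L C : List (Datalog.Literal S)) : List Term :=
  (if neighbours h L C = [] then sharedVars head L (subBody ch path h L C)
    else (sharedVars head L (subBody ch path h L C)).filter (· ≠ h)).map .node

/-- The sub-query atom as it is used at `h`. -/
def subAtom (ch : Choice) (path : List ℕ) (head : Atom (Name S)) (h : Var)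
    (L C : List (Datalog.Literal S)) : Atom (Name S) :=
  ⟨.sub path, h, subArgs ch path head h L C⟩

/-- The head of the rule that defines the sub-query: held at `h` if it can be pushed there along
an edge, and otherwise held where it is evaluated. -/
def subHead (ch : Choice) (path : List ℕ) (head : Atom (Name S)) (h : Var)
    (L C : List (Datalog.Literal S)) : Atom (Name S) :=
  ⟨.sub path, if neighbours h L C = [] then subHolder ch path h L C else h,
    subArgs ch path head h L C⟩

/-- `n` distinct node variables, from `k` on. -/
def freshArgs (k n : ℕ) : List Term := (List.range' k n).map .node

/-- The rule `Q(@x, …) :- Q(@y, …); G(@y, x)` that broadcasts the results of a sub-query, if the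
component is not connected to the local part. -/
def relayRules (path : List ℕ) (h : Var) (L C : List (Datalog.Literal S)) (n : ℕ) :
    Program (Name S) :=
  if neighbours h L C = [] then
    [⟨false, ⟨.sub path, 0, freshArgs 2 n⟩, 1,
      [.rel true ⟨.sub path, 1, freshArgs 2 n⟩, .edge true 1 0]⟩]
  else []

/-- The number of rounds that the transfer of the results of a sub-query takes. -/
def transferTime (Δ : ℕ) (h : Var) (L C : List (Datalog.Literal S)) : ℕ :=
  if neighbours h L C = [] then 1 + Δ else 1

theorem subHolder_mem (ch : Choice) (path : List ℕ) (h : Var) (L C : List (Datalog.Literal S))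
    (hC : C ≠ []) : subHolder ch path h L C ∈ Datalog.holdersOf C := by
  unfold subHolder
  split_ifs with hn
  · apply ch.pick_mem
    obtain ⟨l, C', rfl⟩ := List.exists_cons_of_ne_nil hC
    intro h0
    have h1 : l.atom.holders = [] := by
      simp only [Datalog.holdersOf, List.flatMap_cons, List.append_eq_nil_iff] at h0
      exact h0.1
    cases hl : l.atom <;> simp [hl, Datalog.Atom.holders] at h1
  · have := ch.pick_mem path _ hn
    exact (List.mem_filter.mp this).1

theorem components_spec (CN : List Var) (D : List (Datalog.Literal S)) :
    ((Datalog.components CN D).map List.length).sum = D.length ∧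
      ∀ c ∈ Datalog.components CN D, c ≠ [] ∧ ∀ l ∈ c, l ∈ D := by
  induction D with
  | nil => simp [Datalog.components]
  | cons l D ih =>
    obtain ⟨ih1, ih2⟩ := ih
    have key : ∀ (cs : List (List (Datalog.Literal S))) (p : List (Datalog.Literal S) → Bool),
        ((cs.filter p).map List.length).sum + ((cs.filter fun c => !p c).map List.length).sum
          = (cs.map List.length).sum := by
      intro cs p
      induction cs with
      | nil => simp
      | cons c cs ihc =>
        by_cases hp : p c <;> simp [hp] <;> omega
    have hunf : Datalog.components CN (l :: D) =
        Datalog.insertComponent CN l (Datalog.components CN D) := rfl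
    rw [hunf]
    refine ⟨?_, ?_⟩
    · have := key (Datalog.components CN D) fun c => c.any (l.linked CN)
      simp only [Datalog.insertComponent, List.map_cons, List.length_cons, List.sum_cons,
        List.length_flatten]
      omega
    · intro c hc
      rcases List.mem_cons.mp hc with rfl | hc
      · refine ⟨by simp, fun m hm => ?_⟩
        rcases List.mem_cons.mp hm with rfl | hm
        · simp
        · obtain ⟨c', hc', hm'⟩ := List.mem_flatten.mp hm
          exact List.mem_cons_of_mem _ ((ih2 c' (List.mem_filter.mp hc').1).2 m hm')
      · have := ih2 c (List.mem_filter.mp hc).1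
        exact ⟨this.1, fun m hm => List.mem_cons_of_mem _ (this.2 m hm)⟩

theorem nonlocalPart_subBody_lt (ch : Choice) (path : List ℕ) (h : Var) (CN : List Var)
    (L D C : List (Datalog.Literal S)) (hC : C ∈ Datalog.components CN D) :
    (nonlocalPart (subHolder ch path h L C) (subBody ch path h L C)).length < D.length := by
  obtain ⟨h1, h2⟩ := components_spec CN D
  have hne := (h2 C hC).1
  have hle : C.length ≤ D.length := by
    rw [← h1]
    exact List.le_sum_of_mem (List.mem_map_of_mem hC)
  have hmem := subHolder_mem ch path h L C hne
  have hlt : (nonlocalPart (subHolder ch path h L C) C).length < C.length := by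
    obtain ⟨l, hl, hx⟩ := List.mem_flatMap.mp hmem
    refine List.length_filter_lt_length_iff_exists.mpr ⟨l, hl, ?_⟩
    simp [Datalog.Literal.localAt, hx]
  have heq : nonlocalPart (subHolder ch path h L C) (subBody ch path h L C) =
      nonlocalPart (subHolder ch path h L C) C := by
    by_cases hn : neighbours h L C = []
    · simp [subBody, hn]
    · simp [subBody, hn, nonlocalPart, Datalog.Literal.localAt, Datalog.Atom.holders]
  rw [heq]
  omega

/-- Rewrite the rule `head :- body`, to be evaluated at `h`, into rules whose bodies are local.
The second component is the number of rounds that the evaluation takes. -/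
def rewrite (ch : Choice) (Δ : ℕ) (path : List ℕ) (head : Atom (Name S)) (h : Var)
    (CN : List Var) (body : List (Datalog.Literal S)) : Program (Name S) × ℕ :=
  let L := localPart h body
  if nonlocalPart h body = [] then ([⟨false, head, h, L.map (toNetlog h)⟩], 1)
  else
    let cs := (Datalog.components CN (nonlocalPart h body)).attach.zipIdx
    let main : Rule (Name S) := ⟨false, head, h, L.map (toNetlog h) ++
      cs.map fun c => .rel true (subAtom ch (c.2 :: path) head h L c.1.1)⟩
    let results := cs.map fun c =>
      let p := c.2 :: path
      let x := subHolder ch p h L c.1.1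
      let t := rewrite ch Δ p (subHead ch p head h L c.1.1) x (x :: CN) (subBody ch p h L c.1.1)
      (relayRules p h L c.1.1 (subArgs ch p head h L c.1.1).length ++ t.1,
        t.2 + transferTime Δ h L c.1.1)
    (main :: results.flatMap Prod.fst, (results.map Prod.snd).foldr max 0)
termination_by (nonlocalPart h body).length
decreasing_by
  exact nonlocalPart_subBody_lt ch _ h CN _ _ c.1.1 c.1.2

/-- Steps 1 and 2 for a single rule, the `i`-th one: the leftmost variable of each relation is its
holding variable. -/
def rewriteRule (ch : Choice) (Δ : ℕ) (i : ℕ) (r : Datalog.Rule S) : Program (Name S) × ℕ :=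
  rewrite ch Δ [i] ⟨.base r.head, r.headArgs 0, (List.ofFn (Fin.tail r.headArgs)).map .node⟩
    (r.headArgs 0) [r.headArgs 0] r.body

/-- The program with distributed computation. -/
def distributed (ch : Choice) (Δ : ℕ) (P : Datalog.Program S) : Program (Name S) :=
  P.zipIdx.flatMap fun r => (rewriteRule ch Δ r.2 r.1).1

/-- The number `κ` of rounds of a stage. -/
def kappa (ch : Choice) (Δ : ℕ) (P : Datalog.Program S) : ℕ :=
  max Δ ((P.zipIdx.map fun r => (rewriteRule ch Δ r.2 r.1).2).foldr max 0)

/-- Push the head if it is not held where the body is evaluated. -/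
def addPush (r : Rule (Name S)) : Rule (Name S) :=
  { r with push := decide (r.head.hv ≠ r.hv) }

/-- The atom `clock(@x, t)`. -/
def clockAtom (x : Var) (t : Term) : Atom (Name S) := ⟨.clock, x, [t]⟩

/-- The literals `clock(@x, q); q ≠ 0`. -/
def ticking (x : Var) : List (Literal (Name S)) :=
  [.rel true (clockAtom x (.num 0)), .numNe 0 0]

/-- Relations of the Datalog program are replaced by their temporary copies. -/
def Name.toTemp : Name S → Name S
  | .base R => .temp R
  | n => n

/-- Evaluate the rule only while the clock is not zero, and collect the results for the relations
of the Datalog program in their temporary copies. -/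
def addClock (r : Rule (Name S)) : Rule (Name S) :=
  { r with head := { r.head with rel := r.head.rel.toTemp }, body := r.body ++ ticking r.hv }

/-- `R(x₀, …, xₖ)` with distinct variables, for a relation or its temporary copy. -/
def genericAtom (n : Name S) (k : ℕ) : Atom (Name S) := ⟨n, 0, freshArgs 1 k⟩

/-- The rules that end a stage for the intensional relation `R`. -/
def endOfStage (R : S.Rel) : Program (Name S) :=
  let t := genericAtom (.temp R) (S.ar R)
  let a := genericAtom (.base R) (S.ar R)
  let y := S.ar R + 1
  [⟨false, a, 0, [.rel true t, .rel true (clockAtom 0 (.const 0))]⟩,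
   ⟨false, ⟨.cont, 0, []⟩, 0,
     [.rel true t, .rel false a, .rel true (clockAtom 0 (.const 0))]⟩,
   ⟨true, ⟨.inf, y, [.node 0]⟩, 0,
     [.rel true t, .rel false a, .rel true (clockAtom 0 (.const 0)), .edge true 0 y]⟩]

/-- The rules of the clock and of the detection of termination. Node variables are `x = 0`,
`y = 1`, `z = 2`, number variables are `q = 0`, `p = 1`. The news that a node continues is
forwarded as long as the clock shows at least `θ`. -/
def coordination (κ θ : ℕ) : Program (Name S) :=
  [⟨false, ⟨.cont, 0, []⟩, 0, [.rel true ⟨.start, 0, []⟩]⟩,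
   ⟨true, ⟨.inf, 1, [.node 0]⟩, 0, [.rel true ⟨.start, 0, []⟩, .edge true 0 1]⟩,
   ⟨false, clockAtom 0 (.const κ), 0, [.rel true ⟨.start, 0, []⟩]⟩,
   ⟨false, clockAtom 0 (.num 1), 0,
     [.rel true (clockAtom 0 (.num 0)), .numGe 0 1, .numPred 1 0, .rel false ⟨.halt, 0, []⟩]⟩,
   ⟨false, clockAtom 0 (.const κ), 0,
     [.rel true (clockAtom 0 (.const 0)), .rel false ⟨.halt, 0, []⟩]⟩,
   ⟨true, ⟨.inf, 2, [.node 0]⟩, 1,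
     [.rel true ⟨.inf, 1, [.node 0]⟩, .edge true 1 2, .eq false 0 2,
      .rel true (clockAtom 1 (.num 0)), .numGe 0 θ]⟩,
   ⟨false, ⟨.cont, 0, []⟩, 0, .rel true ⟨.inf, 0, [.node 1]⟩ :: ticking 0⟩,
   ⟨false, ⟨.cont, 0, []⟩, 0, .rel true ⟨.cont, 0, []⟩ :: ticking 0⟩,
   ⟨false, ⟨.halt, 0, []⟩, 0,
     [.rel false ⟨.cont, 0, []⟩, .rel true (clockAtom 0 (.const 0))]⟩]

/-- The program with clocks. -/
def clocked (ch : Choice) (Δ θ : ℕ) (P : Datalog.Program S) : Program (Name S) :=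
  (distributed ch Δ P).map (fun r => addClock (addPush r)) ++
    P.flatMap (fun r => endOfStage r.head) ++ coordination (kappa ch Δ P) θ

/-- Temporary copies and sub-queries are kept until the clock is zero. -/
def keepRules (a : Atom (Name S)) : Program (Name S) :=
  match a.rel with
  | .temp R =>
    let g := genericAtom (.temp R) a.args.length
    [⟨false, g, 0, .rel true g :: ticking 0⟩]
  | .sub p =>
    let g := genericAtom (.sub p) a.args.length
    [⟨false, g, 0, .rel true g :: ticking 0⟩]
  | _ => []

/-- Intensional relations are kept forever. -/
def inflationaryRule (R : S.Rel) : Rule (Name S) :=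
  ⟨false, genericAtom (.base R) (S.ar R), 0, [.rel true (genericAtom (.base R) (S.ar R))]⟩

/-- The rewritten program. -/
def netlogProgram (ch : Choice) (Δ θ : ℕ) (P : Datalog.Program S) : Program (Name S) :=
  clocked ch Δ θ P ++ (clocked ch Δ θ P).flatMap (fun r => keepRules r.head) ++
    P.map fun r => inflationaryRule r.head

/-- At the beginning, the fact `start(@v)` is stored on each node `v`. -/
def startInstance (S : Signature.{u}) (V : Type v) : Set (Fact (Name S) V) :=
  {f | ∃ v : V, f = ⟨.start, v, []⟩}

/-- A fact of the Datalog program as a fact of the rewritten program. -/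
def embed {V : Type v} (f : Datalog.Fact S V) : Fact (Name S) V :=
  ⟨.base f.rel, f.args 0, (List.ofFn (Fin.tail f.args)).map .inl⟩

end Rewriting

/-! ### The tree of queries behind the rewriting -/

namespace Rewriting

open Netlog

variable {S : Signature.{u}}

/-! Stage `i` of the Datalog program is simulated in the rounds from `T = i * (κ + 1) + 1` to `T +
κ`, while all clocks count down from `κ` to `0`. During these rounds the original relations are
frozen at an instance `D`: consequences go to temporary copies, which are released only at clock
zero. Literals, negated ones included, are therefore evaluated against a constant instance, and
sub-queries, which occur only positively, can be sound at every moment and complete after a known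
delay. The one-round behaviour of the program is captured by the inductive predicate `Derives`, so
that no later argument touches rule syntax.

Soundness is an invariant: every stored sub-query fact comes from a valuation that satisfies the
sub-query's body in `D`. To combine such facts, `Reach.glue` merges the valuations of the
components. Two components have only variables of `CN` in common, and those that occur in the body
occur in the head as well (`Reach.mem_head_vars`), so they are transmitted as arguments or by the
holder, and the valuations agree on them.

Completeness, `head_mem_of_holds`, is an induction on the number of nonlocal literals. A component
adjacent to the local part delivers its results in one push; any other one floods the graph, which
takes at most a diameter of further rounds. These are exactly the delays summed up in `κ`.

Termination is decided by news. A node that adds a fact tells its neighbours, and the bounds on `κ`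
and `θ` let the news reach all nodes before clock zero (`NewsAt.cont_mem`), so either all nodes go
on or none does; `1 ≤ θ` keeps old news from leaking into the next stage. Once the fixpoint is
reached, the last news keep the nodes busy for one idle stage, a second idle stage sees no news, and
then all nodes halt at once (`eventually_halted`). As the graph is finite, the inflationary
computation always reaches a fixpoint; hence both computations terminate, and the stage-by-stage
correspondence identifies their limits. -/

/-- A query that occurs in the rewriting: the arguments of a call of `rewrite`. -/
structure Node (S : Signature.{u}) where
  path : List ℕ
  head : Atom (Name S)
  h : Var
  CN : List Var
  body : List (Datalog.Literal S)

namespace Node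

/-- The part of the body that is evaluated at the holding variable. -/
abbrev locals (n : Node S) : List (Datalog.Literal S) := localPart n.h n.body

/-- The components of the rest of the body, with their indices. -/
def comps (n : Node S) : List (List (Datalog.Literal S) × ℕ) :=
  (Datalog.components n.CN (nonlocalPart n.h n.body)).zipIdx

/-- The name of the sub-query for a component. -/
abbrev sub (n : Node S) (c : List (Datalog.Literal S) × ℕ) : List ℕ := c.2 :: n.path

/-- The component is connected to the local part by an edge. -/
def Adjacent (n : Node S) (c : List (Datalog.Literal S) × ℕ) : Prop :=
  neighbours n.h n.locals c.1 ≠ []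

/-- The sub-query for a component. -/
def child (ch : Choice) (n : Node S) (c : List (Datalog.Literal S) × ℕ) : Node S where
  path := n.sub c
  head := subHead ch (n.sub c) n.head n.h n.locals c.1
  h := subHolder ch (n.sub c) n.h n.locals c.1
  CN := subHolder ch (n.sub c) n.h n.locals c.1 :: n.CN
  body := subBody ch (n.sub c) n.h n.locals c.1

/-- The query for a rule of the Datalog program. -/
def root (r : Datalog.Rule S) (i : ℕ) : Node S where
  path := [i]
  head := ⟨.base r.head, r.headArgs 0, (List.ofFn (Fin.tail r.headArgs)).map .node⟩
  h := r.headArgs 0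
  CN := [r.headArgs 0]
  body := r.body

/-- The rules and the number of rounds for a query. -/
abbrev rewritten (ch : Choice) (Δ : ℕ) (n : Node S) : Program (Name S) × ℕ :=
  rewrite ch Δ n.path n.head n.h n.CN n.body

/-- The rule that combines the local part with the results of the sub-queries. -/
def mainRule (ch : Choice) (n : Node S) : Rule (Name S) :=
  ⟨false, n.head, n.h, n.locals.map (toNetlog n.h) ++
    n.comps.map fun c => .rel true (subAtom ch (n.sub c) n.head n.h n.locals c.1)⟩

/-- The rules that broadcast the results of the sub-query for a component. -/
abbrev relay (ch : Choice) (n : Node S) (c : List (Datalog.Literal S) × ℕ) : Program (Name S) :=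
  relayRules (n.sub c) n.h n.locals c.1 (subArgs ch (n.sub c) n.head n.h n.locals c.1).length

end Node

theorem zipIdx_attach_map {α β : Type*} (l : List α) (f : α → ℕ → β) :
    l.attach.zipIdx.map (fun c => f c.1.1 c.2) = l.zipIdx.map fun c => f c.1 c.2 := by
  conv_rhs => rw [← List.attach_map_subtype_val l, List.zipIdx_map, List.map_map]
  rfl

theorem comps_eq_nil {n : Node S} (h : nonlocalPart n.h n.body = []) : n.comps = [] := by
  simp [Node.comps, h, Datalog.components]

/-- One unfolding of the recursion, freed of the `attach` that only serves its termination proof. -/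
theorem rewritten_eq (ch : Choice) (Δ : ℕ) (n : Node S) :
    n.rewritten ch Δ = if nonlocalPart n.h n.body = [] then ([n.mainRule ch], 1) else
      (n.mainRule ch :: n.comps.flatMap fun c =>
          n.relay ch c ++ ((n.child ch c).rewritten ch Δ).1,
        (n.comps.map fun c => ((n.child ch c).rewritten ch Δ).2 +
          transferTime Δ n.h n.locals c.1).foldr max 0) := by
  rw [Node.rewritten, rewrite]
  split_ifs with h0
  · simp [Node.mainRule, comps_eq_nil h0]
  · simp only [Node.mainRule, Node.comps, List.flatMap_def, List.map_map, Function.comp_def]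
    refine Prod.ext ?_ ?_
    · refine congrArg₂ List.cons ?_ ?_
      · congr 2
        exact zipIdx_attach_map _ fun C j =>
          Literal.rel true (subAtom ch (j :: n.path) n.head n.h n.locals C)
      · exact congrArg List.flatten (zipIdx_attach_map _ fun C j =>
          n.relay ch (C, j) ++ ((n.child ch (C, j)).rewritten ch Δ).1)
    · exact congrArg (List.foldr max 0) (zipIdx_attach_map _ fun C j =>
          ((n.child ch (C, j)).rewritten ch Δ).2 + transferTime Δ n.h n.locals C)

theorem mem_components_of_mem_comps {n : Node S} {c : List (Datalog.Literal S) × ℕ}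
    (hc : c ∈ n.comps) : c.1 ∈ Datalog.components n.CN (nonlocalPart n.h n.body) :=
  List.fst_mem_of_mem_zipIdx hc

theorem mem_rewritten (ch : Choice) (Δ : ℕ) (n : Node S) (r : Rule (Name S)) :
    r ∈ (n.rewritten ch Δ).1 ↔ r = n.mainRule ch ∨
      ∃ c ∈ n.comps, r ∈ n.relay ch c ∨ r ∈ ((n.child ch c).rewritten ch Δ).1 := by
  rw [rewritten_eq]
  split_ifs with h0
  · simp [comps_eq_nil h0]
  · simp [List.mem_flatMap]

theorem le_foldr_max {l : List ℕ} {a : ℕ} (h : a ∈ l) : a ≤ l.foldr max 0 := by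
  induction l with
  | nil => simp at h
  | cons b l ih =>
    rcases List.mem_cons.mp h with rfl | h
    · simp
    · simp [ih h]

theorem rounds_child_le (ch : Choice) (Δ : ℕ) (n : Node S) (c : List (Datalog.Literal S) × ℕ)
    (hc : c ∈ n.comps) :
    ((n.child ch c).rewritten ch Δ).2 + transferTime Δ n.h n.locals c.1 ≤
      (n.rewritten ch Δ).2 := by
  rw [rewritten_eq ch Δ n]
  split_ifs with h0
  · simp [comps_eq_nil h0] at hc
  · exact le_foldr_max (List.mem_map_of_mem hc)

theorem child_measure_lt (ch : Choice) (n : Node S) (c : List (Datalog.Literal S) × ℕ)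
    (hc : c ∈ n.comps) :
    (nonlocalPart (n.child ch c).h (n.child ch c).body).length <
      (nonlocalPart n.h n.body).length :=
  nonlocalPart_subBody_lt ch _ n.h n.CN _ _ c.1 (mem_components_of_mem_comps hc)

theorem components_ne_nil (CN : List Var) {D : List (Datalog.Literal S)} (hD : D ≠ []) :
    Datalog.components CN D ≠ [] := by
  obtain ⟨l, D', rfl⟩ := List.exists_cons_of_ne_nil hD
  simp [Datalog.components, Datalog.insertComponent]

/-- The maximum has default value `0`, so a component is needed: there is one as soon as a literal
is nonlocal, and its transfer time is positive. -/
theorem one_le_rounds (ch : Choice) (Δ : ℕ) (n : Node S) : 1 ≤ (n.rewritten ch Δ).2 := by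
  by_cases h0 : nonlocalPart n.h n.body = []
  · rw [rewritten_eq, if_pos h0]
  · obtain ⟨C, cs, hcs⟩ := List.exists_cons_of_ne_nil (components_ne_nil n.CN h0)
    have hc : (C, 0) ∈ n.comps := by simp [Node.comps, hcs]
    have : _ + transferTime Δ n.h n.locals C ≤ _ := rounds_child_le ch Δ n _ hc
    have h1 : 1 ≤ transferTime Δ n.h n.locals C := by
      unfold transferTime
      split_ifs <;> omega
    omega

/-- The queries that occur in the rewriting of `P`. -/
inductive Reach (ch : Choice) (P : Datalog.Program S) : Node S → Prop
  | root (r : Datalog.Rule S) (i : ℕ) (hr : (r, i) ∈ P.zipIdx) : Reach ch P (Node.root r i)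
  | child (n : Node S) (c : List (Datalog.Literal S) × ℕ) (hn : Reach ch P n)
      (hc : c ∈ n.comps) : Reach ch P (n.child ch c)

section

variable {ch : Choice} {P : Datalog.Program S}

theorem eq_of_mem_zipIdx {α : Type*} {l : List α} {a b : α × ℕ} (ha : a ∈ l.zipIdx)
    (hb : b ∈ l.zipIdx) (h : a.2 = b.2) : a = b := by
  rw [List.mem_zipIdx_iff_getElem?] at ha hb
  rw [h, hb] at ha
  exact Prod.ext (Option.some.inj ha).symm h

theorem Reach.path_ne_nil {n : Node S} (hn : Reach ch P n) : n.path ≠ [] := by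
  cases hn <;> simp [Node.root, Node.child]

/-- A path records the index of the rule and of each component chosen on the way down, and paths of
roots are the only ones of length one. Hence a sub-query name determines the query it stands for,
and facts of different sub-queries are never confused. -/
theorem Reach.unique {n : Node S} (hn : Reach ch P n) :
    ∀ {m : Node S}, Reach ch P m → n.path = m.path → n = m := by
  induction hn with
  | root r i hr =>
    intro m hm h
    cases hm with
    | root r' i' hr' =>
      have := eq_of_mem_zipIdx hr hr' (by simpa [Node.root] using h)
      simp_all
    | child m c hm hc =>
      exact absurd (by simpa [Node.root, Node.child] using (List.cons.inj h).2.symm) hm.path_ne_nil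
  | child n c hn hc ih =>
    intro m hm h
    cases hm with
    | root r' i' hr' =>
      exact absurd (by simpa [Node.root, Node.child] using (List.cons.inj h).2) hn.path_ne_nil
    | child m c' hm hc' =>
      obtain ⟨h1, h2⟩ := List.cons.inj h
      obtain rfl := ih hm h2
      rw [eq_of_mem_zipIdx hc hc' h1]

theorem Reach.of_mem_rewritten {Δ : ℕ} {r : Rule (Name S)} (k : ℕ) : ∀ {n : Node S},
    Reach ch P n → (nonlocalPart n.h n.body).length ≤ k → r ∈ (n.rewritten ch Δ).1 →
    ∃ m, Reach ch P m ∧ (r = m.mainRule ch ∨ ∃ c ∈ m.comps, r ∈ m.relay ch c) := by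
  induction k with
  | zero =>
    intro n hn hk hr
    have h0 : n.comps = [] := comps_eq_nil (List.length_eq_zero_iff.mp (Nat.le_zero.mp hk))
    rw [mem_rewritten] at hr
    simp only [h0, List.not_mem_nil, false_and, exists_false, or_false] at hr
    exact ⟨n, hn, .inl hr⟩
  | succ k ih =>
    intro n hn hk hr
    rw [mem_rewritten] at hr
    rcases hr with hr | ⟨c, hc, hr | hr⟩
    · exact ⟨n, hn, .inl hr⟩
    · exact ⟨n, hn, .inr ⟨c, hc, hr⟩⟩
    · have := child_measure_lt ch n c hc
      exact ih (hn.child n c hc) (by omega) hr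

theorem Reach.rewritten_subset {Δ : ℕ} {n : Node S} (hn : Reach ch P n) :
    ∀ r ∈ (n.rewritten ch Δ).1, r ∈ distributed ch Δ P := by
  induction hn with
  | root r i hr => exact fun s hs => List.mem_flatMap.mpr ⟨(r, i), hr, hs⟩
  | child n c hn hc ih =>
    exact fun s hs => ih s ((mem_rewritten ch Δ n s).mpr (.inr ⟨c, hc, .inr hs⟩))

/-- Replaces the recursively built list of rules by the set of reachable queries; everything below
about the distributed program goes through it. -/
theorem mem_distributed {Δ : ℕ} {r : Rule (Name S)} : r ∈ distributed ch Δ P ↔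
    ∃ n, Reach ch P n ∧ (r = n.mainRule ch ∨ ∃ c ∈ n.comps, r ∈ n.relay ch c) := by
  constructor
  · intro hr
    obtain ⟨⟨s, i⟩, hs, hr⟩ := List.mem_flatMap.mp hr
    exact Reach.of_mem_rewritten (Δ := Δ) _ (Reach.root s i hs) le_rfl hr
  · rintro ⟨n, hn, hr | ⟨c, hc, hr⟩⟩
    · exact hn.rewritten_subset (Δ := Δ) r ((mem_rewritten ch Δ n r).mpr (.inl hr))
    · exact hn.rewritten_subset (Δ := Δ) r ((mem_rewritten ch Δ n r).mpr (.inr ⟨c, hc, .inl hr⟩))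

theorem rounds_root_le (Δ : ℕ) {r : Datalog.Rule S} {i : ℕ} (hr : (r, i) ∈ P.zipIdx) :
    ((Node.root r i).rewritten ch Δ).2 ≤ kappa ch Δ P :=
  le_max_of_le_right (le_foldr_max (List.mem_map.mpr ⟨(r, i), hr, rfl⟩))

theorem mem_relay {n : Node S} {c : List (Datalog.Literal S) × ℕ} {r : Rule (Name S)} :
    r ∈ n.relay ch c ↔ ¬ n.Adjacent c ∧
      r = ⟨false, ⟨.sub (n.sub c), 0,
        freshArgs 2 (subArgs ch (n.sub c) n.head n.h n.locals c.1).length⟩, 1,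
      [.rel true ⟨.sub (n.sub c), 1,
        freshArgs 2 (subArgs ch (n.sub c) n.head n.h n.locals c.1).length⟩, .edge true 1 0]⟩ := by
  unfold Node.relay relayRules Node.Adjacent
  split_ifs with h <;> simp [h]

/-! ### The localization restrictions -/

/-- The result of a query can be pushed along an edge to where it is needed. -/
theorem Reach.head_hv {n : Node S} (hn : Reach ch P n) :
    n.head.hv = n.h ∨ (⟨true, .edge n.h n.head.hv⟩ : Datalog.Literal S) ∈ n.body := by
  cases hn with
  | root r i hr => exact .inl rfl
  | child n c hn hc =>
    by_cases h : neighbours n.h n.locals c.1 = []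
    · left; simp [Node.child, subHead, h]
    · right; simp [Node.child, subHead, subBody, h]

theorem toNetlog_hv {h : Var} {l : Datalog.Literal S} (hl : l.localAt h = true) :
    ∀ x ∈ (toNetlog h l).hv?, x = h := by
  obtain ⟨b, a⟩ := l
  cases a with
  | edge x y =>
    simp only [Datalog.Literal.localAt, Datalog.Atom.holders, List.contains_eq_mem,
      List.mem_cons, List.not_mem_nil, or_false, decide_eq_true_eq] at hl
    simp only [toNetlog]
    split_ifs with hx
    · simp [Literal.hv?, hx]
    · rcases hl with rfl | rfl
      · exact absurd rfl hx
      · simp [Literal.hv?]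
  | eq x y => simp [toNetlog, Literal.hv?]
  | rel R args =>
    simp [Datalog.Literal.localAt, Datalog.Atom.holders] at hl
    simp [toNetlog, Literal.hv?, hl]

theorem localized_addClock_addPush {r : Rule (Name S)}
    (h1 : ∀ l ∈ r.body, ∀ x ∈ l.hv?, x = r.hv)
    (h2 : r.head.hv ≠ r.hv → Literal.edge true r.hv r.head.hv ∈ r.body) :
    (addClock (addPush r)).Localized := by
  refine ⟨?_, by simp [addClock, addPush], ?_⟩
  · intro l hl x hx
    rcases List.mem_append.mp hl with hl | hl
    · exact h1 l hl x hx
    · simp only [ticking, List.mem_cons, List.not_mem_nil, or_false] at hl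
      rcases hl with rfl | rfl
      · simpa [Literal.hv?, clockAtom, addPush, addClock, eq_comm] using hx
      · simp [Literal.hv?] at hx
  · intro hp
    exact List.mem_append_left _ (h2 (by simpa [addClock, addPush] using hp))

theorem localized_distributed {Δ : ℕ} {r : Rule (Name S)} (hr : r ∈ distributed ch Δ P) :
    (addClock (addPush r)).Localized := by
  obtain ⟨n, hn, rfl | ⟨c, hc, hr⟩⟩ := mem_distributed.mp hr
  · refine localized_addClock_addPush ?_ ?_
    · intro l hl x hx
      rcases List.mem_append.mp hl with hl | hl
      · obtain ⟨l', hl', rfl⟩ := List.mem_map.mp hl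
        exact toNetlog_hv (List.mem_filter.mp hl').2 x hx
      · obtain ⟨c, hc, rfl⟩ := List.mem_map.mp hl
        simpa [Literal.hv?, subAtom, eq_comm, Node.mainRule] using hx
    · intro hne
      have := hn.head_hv.resolve_left hne
      refine List.mem_append_left _ (List.mem_map.mpr ⟨_, List.mem_filter.mpr ⟨this, ?_⟩, ?_⟩)
      · simp [Datalog.Literal.localAt, Datalog.Atom.holders]
      · simp [toNetlog, Node.mainRule]
  · obtain ⟨_, rfl⟩ := mem_relay.mp hr
    apply localized_addClock_addPush <;> simp [Literal.hv?]

theorem localized_keepRules {a : Atom (Name S)} {r : Rule (Name S)} (hr : r ∈ keepRules a) :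
    r.Localized := by
  unfold keepRules at hr
  split at hr <;> simp at hr <;> subst hr <;>
    simp [Rule.Localized, genericAtom, ticking, Literal.hv?, clockAtom]

theorem localized_netlogProgram {Δ θ : ℕ} {r : Rule (Name S)}
    (hr : r ∈ netlogProgram ch Δ θ P) : r.Localized := by
  simp only [netlogProgram, clocked, List.mem_append, List.mem_flatMap, List.mem_map] at hr
  rcases hr with (((⟨s, hs, rfl⟩ | ⟨s, hs, hr⟩) | hr) | ⟨s, hs, hr⟩) | ⟨s, hs, rfl⟩
  · exact localized_distributed hs
  · simp only [endOfStage, List.mem_cons, List.not_mem_nil, or_false] at hr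
    rcases hr with rfl | rfl | rfl <;>
      simp [Rule.Localized, genericAtom, Literal.hv?, clockAtom]
  · simp only [coordination, List.mem_cons, List.not_mem_nil, or_false] at hr
    rcases hr with rfl | rfl | rfl | rfl | rfl | rfl | rfl | rfl | rfl <;>
      simp [Rule.Localized, Literal.hv?, clockAtom, ticking]
  · exact localized_keepRules hr
  · simp [Rule.Localized, inflationaryRule, genericAtom, Literal.hv?]

end

end Rewriting

/-! ### One round of the rewritten program -/

namespace Rewriting

open Netlog

variable {S : Signature.{u}} {V : Type v}

/-- The fact that a literal held at `y` asks for would be stored on `σ y`, so its presence or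
absence is visible there; edges and comparisons do not read the instance. -/
theorem holds_fragment {N : Type u} {G : SimpleGraph V} {I : Set (Fact N V)} {σ : Var → V}
    {τ : Var → ℕ} {l : Literal N} {y : Var} (hl : ∀ x ∈ l.hv?, x = y) :
    l.Holds G (fragment I (σ y)) σ τ ↔ l.Holds G I σ τ := by
  cases l with
  | rel b a =>
    have : a.hv = y := hl _ (by simp [Literal.hv?])
    subst this
    simp [Literal.Holds, fragment, Atom.eval]
  | _ => rfl

/-- A localized program can be evaluated on the whole instance. -/
theorem mem_consequence_of_localized {N : Type u} {Q : Program N} (hQ : ∀ r ∈ Q, r.Localized)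
    {G : SimpleGraph V} {I : Set (Fact N V)} {f : Fact N V} :
    f ∈ consequence Q G I ↔ ∃ r ∈ Q, ∃ (σ : Var → V) (τ : Var → ℕ),
      (∀ l ∈ r.body, l.Holds G I σ τ) ∧ f = r.head.eval σ τ := by
  refine exists_congr fun r => and_congr_right fun hr => exists_congr fun σ =>
    exists_congr fun τ => and_congr_left fun _ => forall_congr' fun l => forall_congr' fun hl => ?_
  exact holds_fragment ((hQ r hr).1 l hl)

/-- A fact all of whose arguments are nodes. -/
abbrev nodeFact (n : Name S) (v : V) (l : List V) : Fact (Name S) V := ⟨n, v, l.map .inl⟩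

/-- The fact `clock(@v, q)`. -/
abbrev clockFact (S : Signature.{u}) (v : V) (q : ℕ) : Fact (Name S) V := ⟨.clock, v, [.inr q]⟩

/-- The relation occurs in the head of a rule. -/
def Intensional (P : Datalog.Program S) (R : S.Rel) : Prop := ∃ r ∈ P, r.head = R

/-- The arguments of a sub-query besides the holding one, as variables. -/
def Node.subVars (ch : Choice) (n : Node S) (c : List (Datalog.Literal S) × ℕ) : List Var :=
  if neighbours n.h n.locals c.1 = [] then
    sharedVars n.head n.locals (subBody ch (n.sub c) n.h n.locals c.1)
  else (sharedVars n.head n.locals (subBody ch (n.sub c) n.h n.locals c.1)).filter (· ≠ n.h)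

theorem subArgs_eq (ch : Choice) (n : Node S) (c : List (Datalog.Literal S) × ℕ) :
    subArgs ch (n.sub c) n.head n.h n.locals c.1 = (n.subVars ch c).map .node := rfl

theorem map_node_eval (l : List Var) (σ : Var → V) (τ : Var → ℕ) :
    (l.map Term.node).map (Term.eval σ τ) = (l.map σ).map .inl := by
  simp [Term.eval, Function.comp_def]

/-- The facts that the rewritten program derives from the instance `I` in one round. -/
inductive Derives (ch : Choice) (κ θ : ℕ) (P : Datalog.Program S) (G : SimpleGraph V)
    (I : Set (Fact (Name S) V)) : Fact (Name S) V → Prop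
  | main (n : Node S) (hn : Reach ch P n) (σ : Var → V) (τ : Var → ℕ)
      (hl : ∀ l ∈ n.locals, (toNetlog n.h l).Holds G I σ τ)
      (hs : ∀ c ∈ n.comps, nodeFact (.sub (n.sub c)) (σ n.h) ((n.subVars ch c).map σ) ∈ I)
      (hq : clockFact S (σ n.h) (τ 0) ∈ I) (hq0 : τ 0 ≠ 0) :
      Derives ch κ θ P G I
        ⟨n.head.rel.toTemp, σ n.head.hv, n.head.args.map (Term.eval σ τ)⟩
  | relay (n : Node S) (hn : Reach ch P n) (c : List (Datalog.Literal S) × ℕ) (hc : c ∈ n.comps)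
      (hna : ¬ n.Adjacent c) (v w : V) (l : List V) (hl : l.length = (n.subVars ch c).length)
      (hf : nodeFact (.sub (n.sub c)) v l ∈ I) (hvw : G.Adj v w)
      (q : ℕ) (hq : clockFact S v q ∈ I) (hq0 : q ≠ 0) :
      Derives ch κ θ P G I (nodeFact (.sub (n.sub c)) w l)
  | keepSub (n : Node S) (hn : Reach ch P n) (c : List (Datalog.Literal S) × ℕ)
      (hc : c ∈ n.comps) (v : V) (l : List V) (hl : l.length = (n.subVars ch c).length)
      (hf : nodeFact (.sub (n.sub c)) v l ∈ I)
      (q : ℕ) (hq : clockFact S v q ∈ I) (hq0 : q ≠ 0) :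
      Derives ch κ θ P G I (nodeFact (.sub (n.sub c)) v l)
  | keepTemp (R : S.Rel) (hR : Intensional P R) (v : V) (l : List V) (hl : l.length = S.ar R)
      (hf : nodeFact (.temp R) v l ∈ I) (q : ℕ) (hq : clockFact S v q ∈ I) (hq0 : q ≠ 0) :
      Derives ch κ θ P G I (nodeFact (.temp R) v l)
  | keepBase (R : S.Rel) (hR : Intensional P R) (v : V) (l : List V) (hl : l.length = S.ar R)
      (hf : nodeFact (.base R) v l ∈ I) : Derives ch κ θ P G I (nodeFact (.base R) v l)
  | endBase (R : S.Rel) (hR : Intensional P R) (v : V) (l : List V) (hl : l.length = S.ar R)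
      (hf : nodeFact (.temp R) v l ∈ I) (hq : clockFact S v 0 ∈ I) :
      Derives ch κ θ P G I (nodeFact (.base R) v l)
  | endCont (R : S.Rel) (hR : Intensional P R) (v : V) (l : List V) (hl : l.length = S.ar R)
      (hf : nodeFact (.temp R) v l ∈ I) (hnew : nodeFact (.base R) v l ∉ I)
      (hq : clockFact S v 0 ∈ I) : Derives ch κ θ P G I ⟨.cont, v, []⟩
  | endInf (R : S.Rel) (hR : Intensional P R) (v : V) (l : List V) (hl : l.length = S.ar R)
      (hf : nodeFact (.temp R) v l ∈ I) (hnew : nodeFact (.base R) v l ∉ I)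
      (hq : clockFact S v 0 ∈ I) (w : V) (hvw : G.Adj v w) :
      Derives ch κ θ P G I (nodeFact .inf w [v])
  | startCont (v : V) (hv : ⟨.start, v, []⟩ ∈ I) : Derives ch κ θ P G I ⟨.cont, v, []⟩
  | startInf (v w : V) (hv : ⟨.start, v, []⟩ ∈ I) (hvw : G.Adj v w) :
      Derives ch κ θ P G I (nodeFact .inf w [v])
  | startClock (v : V) (hv : ⟨.start, v, []⟩ ∈ I) : Derives ch κ θ P G I (clockFact S v κ)
  | tick (v : V) (q : ℕ) (hq : clockFact S v (q + 1) ∈ I) (hv : ⟨.halt, v, []⟩ ∉ I) :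
      Derives ch κ θ P G I (clockFact S v q)
  | reset (v : V) (hq : clockFact S v 0 ∈ I) (hv : ⟨.halt, v, []⟩ ∉ I) :
      Derives ch κ θ P G I (clockFact S v κ)
  | forward (v w x : V) (hf : nodeFact .inf v [x] ∈ I) (hvw : G.Adj v w) (hxw : x ≠ w) (q : ℕ)
      (hq : clockFact S v q ∈ I) (hθ : θ ≤ q) : Derives ch κ θ P G I (nodeFact .inf w [x])
  | contInf (v x : V) (hf : nodeFact .inf v [x] ∈ I) (q : ℕ) (hq : clockFact S v q ∈ I)
      (hq0 : q ≠ 0) : Derives ch κ θ P G I ⟨.cont, v, []⟩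
  | keepCont (v : V) (hf : ⟨.cont, v, []⟩ ∈ I) (q : ℕ) (hq : clockFact S v q ∈ I)
      (hq0 : q ≠ 0) : Derives ch κ θ P G I ⟨.cont, v, []⟩
  | halt (v : V) (hf : ⟨.cont, v, []⟩ ∉ I) (hq : clockFact S v 0 ∈ I) :
      Derives ch κ θ P G I ⟨.halt, v, []⟩

/-- The valuation that enumerates a list. -/
def listVal (d : V) (l : List V) : Var → V := fun i => l.getD i d

theorem map_listVal (d : V) (l : List V) (s k : ℕ) (h : l.length = s + k) :
    (List.range' s k).map (listVal d l) = l.drop s := by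
  refine List.ext_getElem (by simp; omega) fun i h1 h2 => ?_
  simp only [List.length_map, List.length_range'] at h1
  have : s + i < l.length := by omega
  simp [listVal, List.getElem?_eq_getElem this]

theorem freshArgs_eval (s k : ℕ) (σ : Var → V) (τ : Var → ℕ) :
    (freshArgs s k).map (Term.eval σ τ) = ((List.range' s k).map σ).map .inl :=
  map_node_eval _ _ _

theorem genericAtom_eval (n : Name S) (k : ℕ) (σ : Var → V) (τ : Var → ℕ) :
    (genericAtom n k).eval σ τ = nodeFact n (σ 0) ((List.range' 1 k).map σ) := by
  simp only [Atom.eval, genericAtom, freshArgs_eval]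

theorem genericAtom_eval_listVal (n : Name S) (k : ℕ) (v : V) (l : List V) (hl : l.length = k)
    (τ : Var → ℕ) : (genericAtom n k).eval (listVal v (v :: l)) τ = nodeFact n v l := by
  rw [genericAtom_eval, map_listVal _ _ _ _ (by simp [hl]; omega)]
  simp [listVal]

section

variable {ch : Choice} {P : Datalog.Program S}

theorem Reach.head_rel {n : Node S} (hn : Reach ch P n) :
    (∃ R, Intensional P R ∧ n.head.rel = .base R ∧ n.head.args.length = S.ar R) ∨
    ∃ m, Reach ch P m ∧ ∃ c ∈ m.comps, n.head.rel = .sub (m.sub c) ∧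
      n.head.args.length = (m.subVars ch c).length := by
  cases hn with
  | root r i hr =>
    exact .inl ⟨r.head, ⟨r, List.fst_mem_of_mem_zipIdx hr, rfl⟩, rfl, by simp [Node.root]⟩
  | child m c hm hc =>
    exact .inr ⟨m, hm, c, hc, rfl, by simp [Node.child, subHead, subArgs_eq]⟩

/-- Every intensional relation heads the main rule of some root, and every sub-query that of a
child, so persistence rules exist for all of them. All rules with the same such head relation agree
on its arity, so only the expected rules arise. -/
theorem mem_keepRules {Δ θ : ℕ} {r : Rule (Name S)} :
    (∃ s ∈ clocked ch Δ θ P, r ∈ keepRules s.head) ↔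
      (∃ R, Intensional P R ∧ r = ⟨false, genericAtom (.temp R) (S.ar R), 0,
        .rel true (genericAtom (.temp R) (S.ar R)) :: ticking 0⟩) ∨
      ∃ n, Reach ch P n ∧ ∃ c ∈ n.comps,
        r = ⟨false, genericAtom (.sub (n.sub c)) (n.subVars ch c).length, 0,
          .rel true (genericAtom (.sub (n.sub c)) (n.subVars ch c).length) :: ticking 0⟩ := by
  constructor
  · rintro ⟨s, hs, hr⟩
    simp only [clocked, List.mem_append, List.mem_flatMap, List.mem_map] at hs
    rcases hs with (⟨s, hs, rfl⟩ | ⟨s', hs', hs⟩) | hs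
    · obtain ⟨n, hn, rfl | ⟨c, hc, hs⟩⟩ := mem_distributed.mp hs
      · rcases hn.head_rel with ⟨R, hR, h1, h2⟩ | ⟨m, hm, c, hc, h1, h2⟩
        · left
          refine ⟨R, hR, ?_⟩
          simpa [keepRules, addClock, addPush, Node.mainRule, h1, h2, Name.toTemp] using hr
        · right
          refine ⟨m, hm, c, hc, ?_⟩
          simpa [keepRules, addClock, addPush, Node.mainRule, h1, h2, Name.toTemp] using hr
      · obtain ⟨_, rfl⟩ := mem_relay.mp hs
        right
        refine ⟨n, hn, c, hc, ?_⟩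
        simpa [keepRules, addClock, addPush, Name.toTemp, freshArgs, subArgs_eq] using hr
    · simp only [endOfStage, List.mem_cons, List.not_mem_nil, or_false] at hs
      rcases hs with rfl | rfl | rfl <;> simp [keepRules, genericAtom] at hr
    · simp only [coordination, List.mem_cons, List.not_mem_nil, or_false] at hs
      rcases hs with rfl | rfl | rfl | rfl | rfl | rfl | rfl | rfl | rfl <;>
        simp [keepRules, clockAtom] at hr
  · have key : ∀ n, Reach ch P n → addClock (addPush (n.mainRule ch)) ∈ clocked ch Δ θ P := by
      intro n hn
      refine List.mem_append_left _ (List.mem_append_left _ (List.mem_map_of_mem ?_))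
      exact mem_distributed.mpr ⟨n, hn, .inl rfl⟩
    rintro (⟨R, ⟨s, hs, rfl⟩, rfl⟩ | ⟨n, hn, c, hc, rfl⟩)
    · obtain ⟨i, hi, hsi⟩ := List.getElem_of_mem hs
      have hr : (s, i) ∈ P.zipIdx := by
        rw [List.mk_mem_zipIdx_iff_getElem?, ← hsi, List.getElem?_eq_getElem hi]
      refine ⟨_, key _ (.root s i hr), ?_⟩
      simp [keepRules, addClock, addPush, Node.mainRule, Node.root, Name.toTemp]
    · refine ⟨_, key _ (hn.child n c hc), ?_⟩
      simp [keepRules, addClock, addPush, Node.mainRule, Node.child, subHead, Name.toTemp,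
        subArgs_eq]

variable {G : SimpleGraph V} {I : Set (Fact (Name S) V)} {κ θ : ℕ}

theorem derives_of_mem_coordination {r : Rule (Name S)} (hr : r ∈ coordination κ θ)
    {σ : Var → V} {τ : Var → ℕ} (hb : ∀ l ∈ r.body, l.Holds G I σ τ) :
    Derives ch κ θ P G I (r.head.eval σ τ) := by
  simp only [coordination, List.mem_cons, List.not_mem_nil, or_false] at hr
  rcases hr with rfl | rfl | rfl | rfl | rfl | rfl | rfl | rfl | rfl <;>
    simp [Literal.Holds, Atom.eval, Term.eval, clockAtom, ticking] at hb ⊢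
  · exact .startCont _ hb
  · exact .startInf _ _ hb.1 hb.2
  · exact .startClock _ hb
  · obtain ⟨h1, -, h3, h4⟩ := hb
    exact .tick _ _ (h3 ▸ h1) h4
  · exact .reset _ hb.1 hb.2
  · obtain ⟨h1, h2, h3, h4, h5⟩ := hb
    exact .forward _ _ _ h1 h2 h3 _ h4 h5
  · exact .contInf _ _ hb.1 _ hb.2.1 hb.2.2
  · exact .keepCont _ hb.1 _ hb.2.1 hb.2.2
  · exact .halt _ hb.1 hb.2

theorem derives_of_mem_endOfStage {s : Datalog.Rule S} (hs : s ∈ P) {r : Rule (Name S)}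
    (hr : r ∈ endOfStage s.head) {σ : Var → V} {τ : Var → ℕ}
    (hb : ∀ l ∈ r.body, l.Holds G I σ τ) :
    Derives ch κ θ P G I (r.head.eval σ τ) := by
  have hR : Intensional P s.head := ⟨s, hs, rfl⟩
  have hlen : ((List.range' 1 (S.ar s.head)).map σ).length = S.ar s.head := by simp
  simp only [endOfStage, List.mem_cons, List.not_mem_nil, or_false] at hr
  rcases hr with rfl | rfl | rfl <;>
    simp only [List.forall_mem_cons, List.not_mem_nil, false_imp_iff, implies_true, and_true,
      Literal.Holds, genericAtom_eval, if_true, Bool.false_eq_true, if_false] at hb ⊢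
  · exact .endBase _ hR _ _ hlen hb.1 hb.2
  · exact .endCont _ hR _ _ hlen hb.1 hb.2.1 hb.2.2
  · exact .endInf _ hR _ _ hlen hb.1 hb.2.1 hb.2.2.1 _ hb.2.2.2

theorem derives_of_mem_distributed {Δ : ℕ} {r : Rule (Name S)} (hr : r ∈ distributed ch Δ P)
    {σ : Var → V} {τ : Var → ℕ}
    (hb : ∀ l ∈ (addClock (addPush r)).body, l.Holds G I σ τ) :
    Derives ch κ θ P G I ((addClock (addPush r)).head.eval σ τ) := by
  obtain ⟨n, hn, rfl | ⟨c, hc, hr⟩⟩ := mem_distributed.mp hr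
  · simp only [addClock, addPush, Node.mainRule, ticking, List.forall_mem_append,
      List.forall_mem_cons, List.forall_mem_map] at hb
    obtain ⟨⟨h1, h2⟩, h3, h4, -⟩ := hb
    refine .main n hn σ τ h1 (fun c hc => ?_) h3 h4
    have := h2 c hc
    simpa only [Literal.Holds, if_true, Atom.eval, subAtom, subArgs_eq, map_node_eval] using this
  · obtain ⟨hna, rfl⟩ := mem_relay.mp hr
    simp only [addClock, addPush, ticking, List.forall_mem_append, List.forall_mem_cons,
      Literal.Holds, if_true, Atom.eval, freshArgs_eval, clockAtom] at hb ⊢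
    obtain ⟨⟨h1, h2, -⟩, h3, h4, -⟩ := hb
    exact .relay n hn c hc hna _ _ _ (by simp [subArgs_eq]) h1 h2 _ h3 h4

theorem derives_of_mem_consequence {Δ : ℕ} {f : Fact (Name S) V}
    (hf : f ∈ consequence (netlogProgram ch Δ θ P) G I) :
    Derives ch (kappa ch Δ P) θ P G I f := by
  obtain ⟨r, hr, σ, τ, hb, rfl⟩ :=
    (mem_consequence_of_localized fun _ => localized_netlogProgram).mp hf
  rw [netlogProgram, List.mem_append, List.mem_append, List.mem_flatMap, mem_keepRules] at hr
  rcases hr with (hr | ⟨R, hR, rfl⟩ | ⟨n, hn, c, hc, rfl⟩) | hr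
  · simp only [clocked, List.mem_append, List.mem_flatMap, List.mem_map] at hr
    rcases hr with (⟨s, hs, rfl⟩ | ⟨s, hs, hr⟩) | hr
    · exact derives_of_mem_distributed hs hb
    · exact derives_of_mem_endOfStage hs hr hb
    · exact derives_of_mem_coordination hr hb
  · simp only [ticking, List.forall_mem_cons, Literal.Holds, if_true, genericAtom_eval] at hb ⊢
    exact .keepTemp R hR _ _ (by simp) hb.1 _ hb.2.1 hb.2.2.1
  · simp only [ticking, List.forall_mem_cons, Literal.Holds, if_true, genericAtom_eval] at hb ⊢
    exact .keepSub n hn c hc _ _ (by simp) hb.1 _ hb.2.1 hb.2.2.1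
  · obtain ⟨s, hs, rfl⟩ := List.mem_map.mp hr
    simp only [inflationaryRule, List.forall_mem_cons, Literal.Holds, if_true,
      genericAtom_eval] at hb ⊢
    exact .keepBase _ ⟨s, hs, rfl⟩ _ _ (by simp) hb.1

/-- Outside the main rules, node variables are small consecutive numbers, so the required valuation
is a constant or a `listVal` of the nodes in the order of their variables. -/
theorem mem_consequence_of_derives {Δ : ℕ} {f : Fact (Name S) V}
    (hf : Derives ch (kappa ch Δ P) θ P G I f) :
    f ∈ consequence (netlogProgram ch Δ θ P) G I := by
  have key : ∀ r ∈ netlogProgram ch Δ θ P, ∀ (σ : Var → V) (τ : Var → ℕ),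
      (∀ l ∈ r.body, l.Holds G I σ τ) →
      r.head.eval σ τ ∈ consequence (netlogProgram ch Δ θ P) G I := fun r hr σ τ hb =>
    (mem_consequence_of_localized fun _ => localized_netlogProgram).mpr ⟨r, hr, σ, τ, hb, rfl⟩
  have kdist : ∀ r ∈ distributed ch Δ P, ∀ (σ : Var → V) (τ : Var → ℕ),
      (∀ l ∈ (addClock (addPush r)).body, l.Holds G I σ τ) →
      (addClock (addPush r)).head.eval σ τ ∈ consequence (netlogProgram ch Δ θ P) G I := by
    refine fun r hr => key _ ?_
    simp only [netlogProgram, clocked, List.mem_append]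
    exact .inl (.inl (.inl (.inl (List.mem_map_of_mem hr))))
  have kkeep : ∀ r, (∃ s ∈ clocked ch Δ θ P, r ∈ keepRules s.head) →
      ∀ (σ : Var → V) (τ : Var → ℕ), (∀ l ∈ r.body, l.Holds G I σ τ) →
      r.head.eval σ τ ∈ consequence (netlogProgram ch Δ θ P) G I := by
    refine fun r hr => key _ ?_
    simp only [netlogProgram, List.mem_append, List.mem_flatMap]
    exact .inl (.inr hr)
  have kend : ∀ (R : S.Rel), Intensional P R → ∀ r ∈ endOfStage R, ∀ (σ : Var → V) (τ : Var → ℕ),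
      (∀ l ∈ r.body, l.Holds G I σ τ) →
      r.head.eval σ τ ∈ consequence (netlogProgram ch Δ θ P) G I := by
    rintro R ⟨s, hs, rfl⟩ r hr
    refine key _ ?_
    simp only [netlogProgram, clocked, List.mem_append, List.mem_flatMap]
    exact .inl (.inl (.inl (.inr ⟨s, hs, hr⟩)))
  have kcoord : ∀ r ∈ coordination (S := S) (kappa ch Δ P) θ, ∀ (σ : Var → V) (τ : Var → ℕ),
      (∀ l ∈ r.body, l.Holds G I σ τ) →
      r.head.eval σ τ ∈ consequence (netlogProgram ch Δ θ P) G I := by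
    refine fun r hr => key _ ?_
    simp only [netlogProgram, clocked, List.mem_append]
    exact .inl (.inl (.inr hr))
  cases hf with
  | main n hn σ τ hl hs hq hq0 =>
    refine kdist (n.mainRule ch) (mem_distributed.mpr ⟨n, hn, .inl rfl⟩) σ τ ?_
    simp only [addClock, addPush, Node.mainRule, ticking, List.forall_mem_append,
      List.forall_mem_cons, List.forall_mem_map]
    refine ⟨⟨hl, fun c hc => ?_⟩, hq, hq0, by simp⟩
    have := hs c hc
    simpa only [Literal.Holds, if_true, Atom.eval, subAtom, subArgs_eq, map_node_eval] using this
  | relay n hn c hc hna v w l hl hf hvw q hq hq0 =>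
    have h1 : (List.range' 2 (n.subVars ch c).length).map (listVal v (w :: v :: l)) = l := by
      rw [map_listVal _ _ _ _ (by simp [hl]; omega)]
      rfl
    -- In a relay rule, variable `0` is the receiver, `1` the sender, and the arguments start at
    -- `2`.
    have := kdist _ (mem_distributed.mpr ⟨n, hn, .inr ⟨c, hc, mem_relay.mpr ⟨hna, rfl⟩⟩⟩)
      (listVal v (w :: v :: l)) (fun _ => q) ?_
    · simp only [addClock, addPush, Atom.eval, freshArgs_eval, subArgs_eq, List.length_map,
        h1] at this
      exact this
    · simp only [addClock, addPush, ticking, List.forall_mem_append, List.forall_mem_cons,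
        Literal.Holds, if_true, Atom.eval, freshArgs_eval, clockAtom, subArgs_eq,
        List.length_map, h1]
      exact ⟨⟨hf, hvw, by simp⟩, hq, hq0, by simp⟩
  | keepSub n hn c hc v l hl hf q hq hq0 =>
    have := kkeep _ (mem_keepRules.mpr (.inr ⟨n, hn, c, hc, rfl⟩)) (listVal v (v :: l))
      (fun _ => q) ?_
    · simpa only [genericAtom_eval_listVal _ _ v l hl] using this
    · simp only [ticking, List.forall_mem_cons, Literal.Holds, if_true,
        genericAtom_eval_listVal _ _ v l hl]
      exact ⟨hf, hq, hq0, by simp⟩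
  | keepTemp R hR v l hl hf q hq hq0 =>
    have := kkeep _ (mem_keepRules.mpr (.inl ⟨R, hR, rfl⟩)) (listVal v (v :: l))
      (fun _ => q) ?_
    · simpa only [genericAtom_eval_listVal _ _ v l hl] using this
    · simp only [ticking, List.forall_mem_cons, Literal.Holds, if_true,
        genericAtom_eval_listVal _ _ v l hl]
      exact ⟨hf, hq, hq0, by simp⟩
  | keepBase R hR v l hl hf =>
    obtain ⟨s, hs, rfl⟩ := hR
    have := key (inflationaryRule s.head) (List.mem_append_right _ (List.mem_map.mpr ⟨s, hs, rfl⟩))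
      (listVal v (v :: l)) (fun _ => 0) ?_
    · simpa only [inflationaryRule, genericAtom_eval_listVal _ _ v l hl] using this
    · simpa only [inflationaryRule, List.forall_mem_cons, Literal.Holds, if_true,
        genericAtom_eval_listVal _ _ v l hl, List.not_mem_nil, false_imp_iff, implies_true,
        and_true] using hf
  | endBase R hR v l hl hf hq =>
    have := kend R hR _ List.mem_cons_self (listVal v (v :: l)) (fun _ => 0) ?_
    · simpa only [genericAtom_eval_listVal _ _ v l hl] using this
    · simp only [List.forall_mem_cons, Literal.Holds, if_true,
        genericAtom_eval_listVal _ _ v l hl]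
      exact ⟨hf, hq, by simp⟩
  | endCont R hR v l hl hf hnew hq =>
    have := kend R hR _ (List.mem_cons_of_mem _ List.mem_cons_self) (listVal v (v :: l))
      (fun _ => 0) ?_
    · exact this
    · simp only [List.forall_mem_cons, Literal.Holds, if_true,
        genericAtom_eval_listVal _ _ v l hl]
      exact ⟨hf, by simpa using hnew, hq, by simp⟩
  | endInf R hR v l hl hf hnew hq w hvw =>
    -- The informed neighbour is the variable right after the arguments of `R`, hence `w` at the end
    -- of the list.
    have h1 : (listVal v (v :: (l ++ [w]))) (S.ar R + 1) = w := by
      simp [listVal, ← hl]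
    have h2 : ∀ n : Name S, (genericAtom n (S.ar R)).eval (listVal v (v :: (l ++ [w])))
        (fun _ => 0) = nodeFact n v l := by
      intro n
      rw [genericAtom_eval]
      congr 1
      refine List.ext_getElem (by simp [hl]) fun i h1 h2 => ?_
      simp [listVal, Nat.add_comm 1 i, List.getElem?_append_left h2, List.getElem?_eq_getElem h2]
    have := kend R hR _ (List.mem_cons_of_mem _ (List.mem_cons_of_mem _ List.mem_cons_self))
      (listVal v (v :: (l ++ [w]))) (fun _ => 0) ?_
    · simp only [Atom.eval, h1] at this
      exact this
    · simp only [List.forall_mem_cons, Literal.Holds, if_true, h1, h2]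
      exact ⟨hf, by simpa using hnew, hq, hvw, by simp⟩
  | startCont v hv =>
    exact kcoord ⟨false, ⟨.cont, 0, []⟩, 0, _⟩ (by simp [coordination]; left; rfl) (fun _ => v)
      (fun _ => 0) (by simpa [Literal.Holds, Atom.eval] using hv)
  | startInf v w hv hvw =>
    -- The number `n` is the position of the rule in the list `coordination`, here and in the
    -- remaining cases.
    refine kcoord _ (List.getElem_mem (n := 1) (by simp [coordination])) (listVal v [v, w])
      (fun _ => 0) ?_
    simpa [coordination, Literal.Holds, Atom.eval, listVal] using ⟨hv, hvw⟩
  | startClock v hv =>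
    refine kcoord _ (List.getElem_mem (n := 2) (by simp [coordination])) (fun _ => v)
      (fun _ => 0) ?_
    simpa [coordination, Literal.Holds, Atom.eval, listVal] using hv
  | tick v q hq hv =>
    refine kcoord _ (List.getElem_mem (n := 3) (by simp [coordination])) (fun _ => v)
      (fun i => if i = 0 then q + 1 else q) ?_
    simpa [coordination, Literal.Holds, Atom.eval, clockAtom, Term.eval] using ⟨hq, hv⟩
  | reset v hq hv =>
    refine kcoord _ (List.getElem_mem (n := 4) (by simp [coordination])) (fun _ => v)
      (fun _ => 0) ?_
    simpa [coordination, Literal.Holds, Atom.eval, clockAtom, Term.eval] using ⟨hq, hv⟩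
  | forward v w x hf hvw hxw q hq hθ =>
    refine kcoord _ (List.getElem_mem (n := 5) (by simp [coordination])) (listVal v [x, v, w])
      (fun _ => q) ?_
    simpa [coordination, Literal.Holds, Atom.eval, clockAtom, Term.eval, listVal] using
      ⟨hf, hvw, hxw, hq, hθ⟩
  | contInf v x hf q hq hq0 =>
    refine kcoord _ (List.getElem_mem (n := 6) (by simp [coordination])) (listVal v [v, x])
      (fun _ => q) ?_
    simpa [coordination, Literal.Holds, Atom.eval, clockAtom, Term.eval, listVal, ticking] using
      ⟨hf, hq, hq0⟩
  | keepCont v hf q hq hq0 =>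
    refine kcoord _ (List.getElem_mem (n := 7) (by simp [coordination])) (fun _ => v)
      (fun _ => q) ?_
    simpa [coordination, Literal.Holds, Atom.eval, clockAtom, Term.eval, ticking] using
      ⟨hf, hq, hq0⟩
  | halt v hf hq =>
    refine kcoord _ (List.getElem_mem (n := 8) (by simp [coordination])) (fun _ => v)
      (fun _ => 0) ?_
    simpa [coordination, Literal.Holds, Atom.eval, clockAtom, Term.eval] using ⟨hf, hq⟩

end

end Rewriting

/-! ### Connected components of rule bodies -/

namespace Datalog

variable {S : Signature.{u}} {V : Type v}

theorem mem_varsOf {C : List (Literal S)} {x : Var} :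
    x ∈ varsOf C ↔ ∃ l ∈ C, x ∈ l.atom.vars := List.mem_flatMap

theorem varsOf_mono {C D : List (Literal S)} (h : ∀ l ∈ C, l ∈ D) {x : Var}
    (hx : x ∈ varsOf C) : x ∈ varsOf D := by
  obtain ⟨l, hl, hx⟩ := mem_varsOf.mp hx
  exact mem_varsOf.mpr ⟨l, h l hl, hx⟩

theorem Literal.holds_congr {G : SimpleGraph V} {I : Set (Fact S V)} {l : Literal S}
    {σ ρ : Var → V} (h : ∀ x ∈ l.atom.vars, σ x = ρ x) : l.Holds G I σ ↔ l.Holds G I ρ := by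
  obtain ⟨b, a⟩ := l
  have : a.Holds G I σ ↔ a.Holds G I ρ := by
    cases a with
    | edge x y => simp_all [Atom.Holds, Atom.vars]
    | eq x y => simp_all [Atom.Holds, Atom.vars]
    | rel R args =>
      have : (fun i => σ (args i)) = fun i => ρ (args i) :=
        funext fun i => h _ (List.mem_ofFn.mpr ⟨i, rfl⟩)
      simp only [Atom.Holds, this]
  simp only [Literal.Holds, this]

theorem exists_mem_components (CN : List Var) {D : List (Literal S)} {l : Literal S}
    (hl : l ∈ D) : ∃ c ∈ components CN D, l ∈ c := by
  induction D with
  | nil => simp at hl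
  | cons m D ih =>
    change ∃ c ∈ insertComponent CN m (components CN D), l ∈ c
    rcases List.mem_cons.mp hl with rfl | hl
    · exact ⟨_, List.mem_cons_self, List.mem_cons_self⟩
    · obtain ⟨c, hc, hlc⟩ := ih hl
      by_cases h : c.any (m.linked CN) = true
      · refine ⟨_, List.mem_cons_self, List.mem_cons_of_mem _ (List.mem_flatten.mpr ⟨c, ?_, hlc⟩)⟩
        exact List.mem_filter.mpr ⟨hc, h⟩
      · exact ⟨c, List.mem_cons_of_mem _ (List.mem_filter.mpr ⟨hc, by simpa using h⟩), hlc⟩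

/-- Distinct components have only variables of `CN` in common. -/
theorem pairwise_components (CN : List Var) (D : List (Literal S)) :
    (components CN D).Pairwise fun c c' => ∀ x ∈ varsOf c, x ∈ varsOf c' → x ∈ CN := by
  induction D with
  | nil => exact List.Pairwise.nil
  | cons l D ih =>
    change (insertComponent CN l (components CN D)).Pairwise _
    refine List.pairwise_cons.mpr ⟨?_, ih.filter _⟩
    intro c hc x hx hxc
    obtain ⟨hc, hnl⟩ := List.mem_filter.mp hc
    obtain ⟨m, hm, hxm⟩ := mem_varsOf.mp hx
    rcases List.mem_cons.mp hm with rfl | hm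
    · obtain ⟨k, hk, hxk⟩ := mem_varsOf.mp hxc
      by_contra hCN
      have : c.any (m.linked CN) = true := by
        refine List.any_eq_true.mpr ⟨k, hk, List.any_eq_true.mpr ⟨x, hxm, ?_⟩⟩
        simp [hxk, hCN]
      simp [this] at hnl
    -- The variable comes from an old component merged into the new one. As `c` was not merged, it
    -- is a different old component, and the induction hypothesis applies.
    · obtain ⟨c', hc', hm⟩ := List.mem_flatten.mp hm
      obtain ⟨hc', hlk⟩ := List.mem_filter.mp hc'
      have hne : c' ≠ c := by
        rintro rfl
        simp [hlk] at hnl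
      have hsymm : ∀ {a b : List (Literal S)}, (∀ x ∈ varsOf a, x ∈ varsOf b → x ∈ CN) →
          ∀ x ∈ varsOf b, x ∈ varsOf a → x ∈ CN := fun h x hb ha => h x ha hb
      have : Std.Symm fun a b : List (Literal S) => ∀ x ∈ varsOf a, x ∈ varsOf b → x ∈ CN :=
        ⟨fun _ _ => hsymm⟩
      exact ih.forall hc' hc hne x (mem_varsOf.mpr ⟨m, hm, hxm⟩) hxc

end Datalog

/-! ### Shared variables and gluing of valuations -/

namespace Rewriting

open Netlog

variable {S : Signature.{u}} {V : Type v} {ch : Choice} {P : Datalog.Program S}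

theorem Node.comps_disjoint {n : Node S} {c d : List (Datalog.Literal S) × ℕ}
    (hc : c ∈ n.comps) (hd : d ∈ n.comps) (hne : c ≠ d) {x : Var}
    (hx : x ∈ Datalog.varsOf c.1) (hx' : x ∈ Datalog.varsOf d.1) : x ∈ n.CN := by
  have hpw := List.pairwise_iff_getElem.mp
    (Datalog.pairwise_components n.CN (nonlocalPart n.h n.body))
  have hne' : c.2 ≠ d.2 := fun h => hne (eq_of_mem_zipIdx hc hd h)
  obtain ⟨hc1, hc2⟩ := List.getElem?_eq_some_iff.mp (List.mem_zipIdx_iff_getElem?.mp hc)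
  obtain ⟨hd1, hd2⟩ := List.getElem?_eq_some_iff.mp (List.mem_zipIdx_iff_getElem?.mp hd)
  rw [← hc2] at hx
  rw [← hd2] at hx'
  rcases lt_or_gt_of_ne hne' with h | h
  · exact hpw _ _ hc1 hd1 h x hx hx'
  · exact hpw _ _ hd1 hc1 h x hx' hx

theorem Node.mem_body_of_mem_comps {n : Node S} {c : List (Datalog.Literal S) × ℕ}
    (hc : c ∈ n.comps) {l : Datalog.Literal S} (hl : l ∈ c.1) : l ∈ n.body :=
  (List.mem_filter.mp (((components_spec _ _).2 c.1 (mem_components_of_mem_comps hc)).2 l hl)).1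

theorem Node.exists_mem_comps {n : Node S} {l : Datalog.Literal S} (hl : l ∈ n.body)
    (hn : l ∉ n.locals) : ∃ c ∈ n.comps, l ∈ c.1 := by
  have : l ∈ nonlocalPart n.h n.body := by
    simp_all [Node.locals, localPart, nonlocalPart]
  obtain ⟨C, hC, hlC⟩ := Datalog.exists_mem_components n.CN this
  obtain ⟨i, hi, rfl⟩ := List.getElem_of_mem hC
  refine ⟨(_, i), ?_, hlC⟩
  rw [Node.comps, List.mk_mem_zipIdx_iff_getElem?, List.getElem?_eq_getElem hi]

theorem mem_subBody {n : Node S} {c : List (Datalog.Literal S) × ℕ} {l : Datalog.Literal S} :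
    l ∈ (n.child ch c).body ↔ l ∈ c.1 ∨
      n.Adjacent c ∧ l = ⟨true, .edge (n.child ch c).h n.h⟩ := by
  by_cases h : neighbours n.h n.locals c.1 = []
  · simp [Node.child, subBody, Node.Adjacent, h]
  · simp [Node.child, subBody, Node.Adjacent, h, or_comm]

theorem mem_varsOf_subBody {n : Node S} {c : List (Datalog.Literal S) × ℕ} {x : Var} :
    x ∈ Datalog.varsOf (n.child ch c).body ↔ x ∈ Datalog.varsOf c.1 ∨
      n.Adjacent c ∧ (x = (n.child ch c).h ∨ x = n.h) := by
  simp only [Datalog.mem_varsOf, mem_subBody]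
  constructor
  · rintro ⟨l, hl | ⟨ha, rfl⟩, hx⟩
    · exact .inl ⟨l, hl, hx⟩
    · exact .inr ⟨ha, by simpa [Datalog.Atom.vars] using hx⟩
  · rintro (⟨l, hl, hx⟩ | ⟨ha, hx⟩)
    · exact ⟨l, .inl hl, hx⟩
    · exact ⟨_, .inr ⟨ha, rfl⟩, by simpa [Datalog.Atom.vars] using hx⟩

theorem mem_subVars {n : Node S} {c : List (Datalog.Literal S) × ℕ} {x : Var} :
    x ∈ n.subVars ch c ↔ x ∈ Datalog.varsOf (n.child ch c).body ∧
      (x ∈ Datalog.varsOf n.locals ∨ x ∈ n.head.vars) ∧ (n.Adjacent c → x ≠ n.h) := by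
  unfold Node.subVars Node.Adjacent
  split_ifs with h <;> simp [sharedVars, Node.child, h, and_assoc]

theorem adjacent_spec {n : Node S} {c : List (Datalog.Literal S) × ℕ} (h : n.Adjacent c) :
    ∃ l ∈ n.locals, Datalog.Literal.isEdge n.h (n.child ch c).h l = true := by
  have := ch.pick_mem (n.sub c) _ h
  have he : (n.child ch c).h = ch.pick (n.sub c) (neighbours n.h n.locals c.1) := by
    simp [Node.child, subHolder, show neighbours n.h n.locals c.1 ≠ [] from h]
  rw [he]
  exact List.any_eq_true.mp (List.mem_filter.mp this).2

theorem isEdge_spec {h x : Var} {l : Datalog.Literal S} (hl : l.isEdge h x = true) :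
    l = ⟨true, .edge h x⟩ ∨ l = ⟨true, .edge x h⟩ := by
  obtain ⟨b, a⟩ := l
  unfold Datalog.Literal.isEdge at hl
  split at hl
  · simp_all
  · simp at hl

theorem child_head_hv_of_adjacent {n : Node S} {c : List (Datalog.Literal S) × ℕ}
    (h : n.Adjacent c) : (n.child ch c).head.hv = n.h := if_neg h

theorem child_head_hv_of_not_adjacent {n : Node S} {c : List (Datalog.Literal S) × ℕ}
    (h : ¬ n.Adjacent c) : (n.child ch c).head.hv = (n.child ch c).h := if_pos (not_not.mp h)

theorem mem_child_head_vars {n : Node S} {c : List (Datalog.Literal S) × ℕ} {x : Var} :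
    x ∈ (n.child ch c).head.vars ↔ x = (n.child ch c).head.hv ∨ x ∈ n.subVars ch c := by
  have : (n.child ch c).head.args = (n.subVars ch c).map .node := rfl
  simp [Atom.vars, this]

/-- The head of a query contains the variables of `CN` that occur in its body. -/
theorem Reach.mem_head_vars {n : Node S} (hn : Reach ch P n) :
    ∀ x ∈ n.CN, x ∈ Datalog.varsOf n.body → x ∈ n.head.vars := by
  induction hn with
  | root r i hr =>
    intro x hx _
    simp only [Node.root, List.mem_cons, List.not_mem_nil, or_false] at hx
    simp [Node.root, Atom.vars, hx]
  | child n c hn hc ih =>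
    intro x hx hxb
    rw [mem_child_head_vars]
    by_cases ha : n.Adjacent c
    · rw [child_head_hv_of_adjacent ha]
      by_cases hxh : x = n.h
      · exact .inl hxh
      · refine .inr (mem_subVars.mpr ⟨hxb, ?_, fun _ => hxh⟩)
        -- The new member of `CN` occurs in the local edge that makes the component adjacent, so it
        -- is shared with the local part; the old members are shared with the head by induction.
        by_cases hxc : x = (n.child ch c).h
        · obtain ⟨l, hl, he⟩ := adjacent_spec (ch := ch) ha
          refine .inl (Datalog.mem_varsOf.mpr ⟨l, hl, ?_⟩)
          rcases isEdge_spec he with rfl | rfl <;> simp [Datalog.Atom.vars, hxc]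
        · refine .inr (ih x ((List.mem_cons.mp hx).resolve_left hxc) ?_)
          refine Datalog.varsOf_mono (fun l => Node.mem_body_of_mem_comps hc)
            ((mem_varsOf_subBody.mp hxb).resolve_right ?_)
          rintro ⟨-, h | h⟩
          exacts [hxc h, hxh h]
    · rw [child_head_hv_of_not_adjacent ha]
      rcases List.mem_cons.mp hx with hx | hx
      · exact .inl hx
      · refine .inr (mem_subVars.mpr ⟨hxb, .inr (ih x hx ?_), fun h => absurd h ha⟩)
        refine Datalog.varsOf_mono (fun l => Node.mem_body_of_mem_comps hc)
          ((mem_varsOf_subBody.mp hxb).resolve_right fun h => ha h.1)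

variable {G : SimpleGraph V} {D : Set (Datalog.Fact S V)} {I : Set (Fact (Name S) V)} {κ θ : ℕ}

/-- Valuations of the local part and of the components that agree on the shared variables can be
glued to a valuation of the whole body. -/
theorem Reach.glue {n : Node S} (hn : Reach ch P n) {σ : Var → V}
    (hl : ∀ l ∈ n.locals, l.Holds G D σ)
    (hs : ∀ c ∈ n.comps, ∃ ρ : Var → V, (∀ l ∈ c.1, l.Holds G D ρ) ∧
      ∀ x ∈ Datalog.varsOf c.1, x ∈ Datalog.varsOf n.locals ∨ x ∈ n.head.vars → ρ x = σ x) :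
    ∃ ρ : Var → V, (∀ l ∈ n.body, l.Holds G D ρ) ∧ ∀ x ∈ n.head.vars, ρ x = σ x := by
  classical
  have : Nonempty (Var → V) := ⟨σ⟩
  choose! ρ hρ1 hρ2 using hs
  -- Shared variables keep their value, any other variable takes it from a component in which it
  -- occurs. That component is unique: a variable of two components lies in `CN`, hence in the head,
  -- and is shared.
  let σ' : Var → V := fun x =>
    if x ∈ Datalog.varsOf n.locals ∨ x ∈ n.head.vars then σ x
    else if h : ∃ c ∈ n.comps, x ∈ Datalog.varsOf c.1 then ρ h.choose x else σ x
  have hshared : ∀ x, x ∈ Datalog.varsOf n.locals ∨ x ∈ n.head.vars → σ' x = σ x :=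
    fun x hx => if_pos hx
  refine ⟨σ', fun l hlb => ?_, fun x hx => hshared x (.inr hx)⟩
  by_cases hloc : l ∈ n.locals
  · refine (Datalog.Literal.holds_congr fun x hx => ?_).mpr (hl l hloc)
    exact hshared x (.inl (Datalog.mem_varsOf.mpr ⟨l, hloc, hx⟩))
  · obtain ⟨c, hc, hlc⟩ := Node.exists_mem_comps hlb hloc
    refine (Datalog.Literal.holds_congr fun x hx => ?_).mpr (hρ1 c hc l hlc)
    have hxc : x ∈ Datalog.varsOf c.1 := Datalog.mem_varsOf.mpr ⟨l, hlc, hx⟩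
    by_cases hsh : x ∈ Datalog.varsOf n.locals ∨ x ∈ n.head.vars
    · rw [hshared x hsh, hρ2 c hc x hxc hsh]
    · have hex : ∃ c ∈ n.comps, x ∈ Datalog.varsOf c.1 := ⟨c, hc, hxc⟩
      have h1 : σ' x = ρ hex.choose x := by simp only [σ', if_neg hsh, dif_pos hex]
      have h2 : hex.choose = c := by
        by_contra hne
        have hCN := Node.comps_disjoint hex.choose_spec.1 hc hne hex.choose_spec.2 hxc
        exact hsh (.inr (hn.mem_head_vars x hCN (Datalog.mem_varsOf.mpr ⟨l, hlb, hx⟩)))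
      rw [h1, h2]

/-! ### Soundness of stored results -/

/-- The instance `I` contains exactly the facts of `D` for the relations of the Datalog program. -/
def Represents (I : Set (Fact (Name S) V)) (D : Set (Datalog.Fact S V)) : Prop :=
  ∀ R v args, (⟨.base R, v, args⟩ : Fact (Name S) V) ∈ I ↔ ⟨.base R, v, args⟩ ∈ embed '' D

theorem embed_injective : Function.Injective (embed (S := S) (V := V)) := by
  rintro ⟨R, a⟩ ⟨R', a'⟩ h
  simp only [embed, Fact.mk.injEq, Name.base.injEq] at h
  obtain ⟨rfl, h0, h1⟩ := h
  have h2 := List.ofFn_injective (List.map_injective_iff.mpr Sum.inl_injective h1)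
  rw [← Fin.cons_self_tail a, ← Fin.cons_self_tail a', h0, h2]

theorem Represents.embed_mem (h : Represents I D) (f : Datalog.Fact S V) :
    embed f ∈ I ↔ f ∈ D :=
  (h _ _ _).trans embed_injective.mem_set_image

/-- Negated literals are covered because `Represents` is an equivalence, and reoriented edges
because `G` is symmetric. -/
theorem toNetlog_holds (h : Represents I D) (y : Var) (l : Datalog.Literal S) (σ : Var → V)
    (τ : Var → ℕ) : (toNetlog y l).Holds G I σ τ ↔ l.Holds G D σ := by
  obtain ⟨b, a⟩ := l
  cases a with
  | edge x y =>
    simp only [toNetlog]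
    split_ifs
    · rfl
    · simp [Literal.Holds, Datalog.Literal.Holds, Datalog.Atom.Holds, G.adj_comm]
  | eq x y => rfl
  | rel R args =>
    have := h.embed_mem ⟨R, fun i => σ (args i)⟩
    simp only [toNetlog, Literal.Holds, Datalog.Literal.Holds, Datalog.Atom.Holds, Atom.eval,
      map_node_eval]
    rw [← this, List.map_ofFn]
    rfl

/-- The stored results of sub-queries are correct. -/
def SubSound (ch : Choice) (P : Datalog.Program S) (G : SimpleGraph V)
    (D : Set (Datalog.Fact S V)) (I : Set (Fact (Name S) V)) : Prop :=
  ∀ p w args, (⟨.sub p, w, args⟩ : Fact (Name S) V) ∈ I → ∃ n, Reach ch P n ∧ ∃ c ∈ n.comps,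
    p = n.sub c ∧ ∃ ρ : Var → V, (∀ l ∈ (n.child ch c).body, l.Holds G D ρ) ∧
      args = ((n.subVars ch c).map ρ).map .inl ∧ (n.Adjacent c → w = ρ n.h)

/-- The copy of a fact of the Datalog program in the temporary relation. -/
def tempFact (f : Datalog.Fact S V) : Fact (Name S) V :=
  ⟨.temp f.rel, f.args 0, (List.ofFn (Fin.tail f.args)).map .inl⟩

/-- The contents of the temporary relations are immediate consequences. -/
def TempSound (P : Datalog.Program S) (G : SimpleGraph V)
    (D : Set (Datalog.Fact S V)) (I : Set (Fact (Name S) V)) : Prop :=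
  ∀ R w args, (⟨.temp R, w, args⟩ : Fact (Name S) V) ∈ I →
    ∃ f ∈ Datalog.consequence P G D, ⟨.temp R, w, args⟩ = tempFact f

/-- A main rule may fire under a `σ` that is arbitrary on variables hidden inside sub-queries;
gluing the witnesses of the sub-query facts repairs `σ` there without changing the derived head. -/
theorem exists_valuation_of_main (hI : Represents I D) (hsub : SubSound ch P G D I) {n : Node S}
    (hn : Reach ch P n) {σ : Var → V} {τ : Var → ℕ}
    (hl : ∀ l ∈ n.locals, (toNetlog n.h l).Holds G I σ τ)
    (hs : ∀ c ∈ n.comps, nodeFact (.sub (n.sub c)) (σ n.h) ((n.subVars ch c).map σ) ∈ I) :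
    ∃ ρ : Var → V, (∀ l ∈ n.body, l.Holds G D ρ) ∧ ∀ x ∈ n.head.vars, ρ x = σ x := by
  refine hn.glue (fun l h => (toNetlog_holds hI _ l σ τ).mp (hl l h)) fun c hc => ?_
  obtain ⟨m, hm, d, hd, hp, ρ, hb, hargs, hw⟩ := hsub _ _ _ (hs c hc)
  obtain ⟨h1, h2⟩ := List.cons.inj hp
  obtain rfl := hn.unique hm h2
  obtain rfl := eq_of_mem_zipIdx hc hd h1
  refine ⟨ρ, fun l h => hb l (mem_subBody.mpr (.inl h)), fun x hx hsh => ?_⟩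
  have hmap := List.map_injective_iff.mpr Sum.inl_injective hargs
  -- For an adjacent component `h` is not among the arguments; its value is read off from the holder
  -- of the fact. Otherwise every shared variable is an argument and the holder carries no
  -- information.
  by_cases hxh : n.Adjacent c ∧ x = n.h
  · rw [hxh.2, hw hxh.1]
  · have : x ∈ n.subVars ch c :=
      mem_subVars.mpr ⟨mem_varsOf_subBody.mpr (.inl hx), hsh, fun ha h => hxh ⟨ha, h⟩⟩
    exact (List.map_inj_left.mp hmap x this).symm

/-- Relaying changes only the holder, and only non-adjacent components are relayed, for which
`SubSound` does not constrain the holder. -/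
theorem Derives.sub_sound (hI : Represents I D) (hsub : SubSound ch P G D I) :
    SubSound ch P G D {f | Derives ch κ θ P G I f} := by
  intro p w args h
  generalize hf : (⟨.sub p, w, args⟩ : Fact (Name S) V) = f at h
  cases h with
  | main n hn σ τ hl hs hq hq0 =>
    obtain ⟨ρ, hb, hρ⟩ := exists_valuation_of_main hI hsub hn hl hs
    obtain ⟨h1, rfl, rfl⟩ := Fact.mk.inj hf
    cases hn with
    | root r i hr => simp [Node.root, Name.toTemp] at h1
    | child n c hn hc =>
      refine ⟨n, hn, c, hc, by simpa [Node.child, subHead, Name.toTemp] using h1, ρ, hb, ?_, ?_⟩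
      · have : (n.child ch c).head.args = (n.subVars ch c).map .node := rfl
        rw [this, map_node_eval]
        congr 1
        exact List.map_inj_left.mpr fun x hx => (hρ x (mem_child_head_vars.mpr (.inr hx))).symm
      · intro ha
        rw [← hρ _ (mem_child_head_vars.mpr (.inl rfl)), child_head_hv_of_adjacent ha]
  | relay n hn c hc hna v w' l hl hf' hvw q hq hq0 =>
    obtain ⟨h1, rfl, rfl⟩ := Fact.mk.inj hf
    obtain ⟨m, hm, d, hd, hp, ρ, hb, hargs, -⟩ := hsub _ _ _ hf'
    obtain ⟨h3, h4⟩ := List.cons.inj hp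
    obtain rfl := hn.unique hm h4
    obtain rfl := eq_of_mem_zipIdx hc hd h3
    exact ⟨n, hn, c, hc, Name.sub.inj h1, ρ, hb, hargs, fun h => absurd h hna⟩
  | keepSub n hn c hc v l hl hf' q hq hq0 =>
    rw [← hf] at hf'
    exact hsub _ _ _ hf'
  | _ => simp at hf

theorem Derives.temp_sound (hI : Represents I D) (hsub : SubSound ch P G D I)
    (htemp : TempSound P G D I) : TempSound P G D {f | Derives ch κ θ P G I f} := by
  intro p w args h
  generalize hf : (⟨.temp p, w, args⟩ : Fact (Name S) V) = f at h
  cases h with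
  | main n hn σ τ hl hs hq hq0 =>
    obtain ⟨ρ, hb, hρ⟩ := exists_valuation_of_main hI hsub hn hl hs
    obtain ⟨h1, rfl, rfl⟩ := Fact.mk.inj hf
    cases hn with
    | root r i hr =>
      refine ⟨⟨r.head, fun i => ρ (r.headArgs i)⟩,
        ⟨r, List.fst_mem_of_mem_zipIdx hr, ρ, hb, rfl⟩, ?_⟩
      have hρ' : ∀ i, ρ (r.headArgs i) = σ (r.headArgs i) := by
        intro i
        refine hρ _ ?_
        simp only [Node.root, Atom.vars, List.mem_cons, List.mem_filterMap]
        refine Fin.cases (.inl rfl) (fun j => .inr ⟨.node (r.headArgs j.succ), ?_, rfl⟩) i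
        exact List.mem_map_of_mem (List.mem_ofFn.mpr ⟨j, rfl⟩)
      obtain rfl := Name.temp.inj h1
      simp only [hρ', tempFact, Node.root, map_node_eval]
      rw [List.map_ofFn]
      rfl
    | child n c hn hc => simp [Node.child, subHead, Name.toTemp] at h1
  | keepTemp R hR v l hl hf' q hq hq0 =>
    exact htemp _ _ _ hf'
  | _ => simp at hf

/-! ### Where the facts of each relation can come from -/

/-- This rules out the case `main` in the inversions for original and coordinating relations. -/
theorem Reach.head_toTemp {n : Node S} (hn : Reach ch P n) :
    (∃ R, n.head.rel.toTemp = .temp R) ∨ ∃ p, n.head.rel.toTemp = .sub p := by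
  rcases hn.head_rel with ⟨R, -, h, -⟩ | ⟨m, -, c, -, h, -⟩
  · exact .inl ⟨R, by rw [h]; rfl⟩
  · exact .inr ⟨_, by rw [h]; rfl⟩

theorem Derives.not_start {v : V} {args : List (V ⊕ ℕ)} :
    ¬ Derives ch κ θ P G I ⟨.start, v, args⟩ := by
  intro h
  generalize hf : (⟨.start, v, args⟩ : Fact (Name S) V) = f at h
  cases h with
  | main n hn =>
    rcases hn.head_toTemp with ⟨_, e⟩ | ⟨_, e⟩ <;> simp [e] at hf
  | _ => simp at hf

theorem Derives.clock_inv {v : V} {args : List (V ⊕ ℕ)}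
    (h : Derives ch κ θ P G I ⟨.clock, v, args⟩) : ∃ q, args = [.inr q] ∧
      ((⟨.start, v, []⟩ ∈ I ∧ q = κ) ∨ ⟨.halt, v, []⟩ ∉ I ∧
        (clockFact S v (q + 1) ∈ I ∨ clockFact S v 0 ∈ I ∧ q = κ)) := by
  generalize hf : (⟨.clock, v, args⟩ : Fact (Name S) V) = f at h
  cases h with
  | main n hn =>
    rcases hn.head_toTemp with ⟨_, e⟩ | ⟨_, e⟩ <;> simp [e] at hf
  | startClock w hw =>
    obtain ⟨-, rfl, rfl⟩ := Fact.mk.inj hf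
    exact ⟨_, rfl, .inl ⟨hw, rfl⟩⟩
  | tick w q hq hw =>
    obtain ⟨-, rfl, rfl⟩ := Fact.mk.inj hf
    exact ⟨_, rfl, .inr ⟨hw, .inl hq⟩⟩
  | reset w hq hw =>
    obtain ⟨-, rfl, rfl⟩ := Fact.mk.inj hf
    exact ⟨_, rfl, .inr ⟨hw, .inr ⟨hq, rfl⟩⟩⟩
  | _ => simp at hf

theorem Derives.halt_inv {v : V} {args : List (V ⊕ ℕ)}
    (h : Derives ch κ θ P G I ⟨.halt, v, args⟩) :
    args = [] ∧ ⟨.cont, v, []⟩ ∉ I ∧ clockFact S v 0 ∈ I := by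
  generalize hf : (⟨.halt, v, args⟩ : Fact (Name S) V) = f at h
  cases h with
  | main n hn =>
    rcases hn.head_toTemp with ⟨_, e⟩ | ⟨_, e⟩ <;> simp [e] at hf
  | halt w h1 h2 =>
    obtain ⟨-, rfl, rfl⟩ := Fact.mk.inj hf
    exact ⟨rfl, h1, h2⟩
  | _ => simp at hf

theorem Derives.base_inv {R : S.Rel} {v : V} {args : List (V ⊕ ℕ)}
    (h : Derives ch κ θ P G I ⟨.base R, v, args⟩) :
    ⟨.base R, v, args⟩ ∈ I ∨ ⟨.temp R, v, args⟩ ∈ I ∧ clockFact S v 0 ∈ I := by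
  generalize hf : (⟨.base R, v, args⟩ : Fact (Name S) V) = f at h
  cases h with
  | main n hn =>
    rcases hn.head_toTemp with ⟨_, e⟩ | ⟨_, e⟩ <;> simp [e] at hf
  | keepBase R' hR v' l hl hf' => exact .inl (hf ▸ hf')
  | endBase R' hR v' l hl hf' hq =>
    obtain ⟨h1, rfl, rfl⟩ := Fact.mk.inj hf
    obtain rfl := Name.base.inj h1
    exact .inr ⟨hf', hq⟩
  | _ => simp at hf

theorem Derives.temp_inv {R : S.Rel} {v : V} {args : List (V ⊕ ℕ)}
    (h : Derives ch κ θ P G I ⟨.temp R, v, args⟩) :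
    ∃ w q, clockFact S w q ∈ I ∧ q ≠ 0 := by
  generalize hf : (⟨.temp R, v, args⟩ : Fact (Name S) V) = f at h
  cases h with
  | main n hn σ τ hl hs hq hq0 => exact ⟨_, _, hq, hq0⟩
  | keepTemp R hR v l hl hf' q hq hq0 => exact ⟨_, _, hq, hq0⟩
  | _ => simp at hf

theorem Derives.sub_inv {p : List ℕ} {v : V} {args : List (V ⊕ ℕ)}
    (h : Derives ch κ θ P G I ⟨.sub p, v, args⟩) :
    ∃ w q, clockFact S w q ∈ I ∧ q ≠ 0 := by
  generalize hf : (⟨.sub p, v, args⟩ : Fact (Name S) V) = f at h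
  cases h with
  | main n hn σ τ hl hs hq hq0 => exact ⟨_, _, hq, hq0⟩
  | relay n hn c hc hna v w l hl hf' hvw q hq hq0 => exact ⟨_, _, hq, hq0⟩
  | keepSub n hn c hc v l hl hf' q hq hq0 => exact ⟨_, _, hq, hq0⟩
  | _ => simp at hf

/-- A temporary relation contains a fact that is going to be added. -/
def HasNews (I : Set (Fact (Name S) V)) : Prop :=
  ∃ R v args, (⟨.temp R, v, args⟩ : Fact (Name S) V) ∈ I ∧ ⟨.base R, v, args⟩ ∉ I ∧
    clockFact S v 0 ∈ I

theorem Derives.cont_inv {v : V} {args : List (V ⊕ ℕ)}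
    (h : Derives ch κ θ P G I ⟨.cont, v, args⟩) :
    ⟨.start, v, []⟩ ∈ I ∨ HasNews I ∨ ∃ q, clockFact S v q ∈ I ∧ q ≠ 0 ∧
      ((∃ x, nodeFact .inf v [x] ∈ I) ∨ ⟨.cont, v, []⟩ ∈ I) := by
  generalize hf : (⟨.cont, v, args⟩ : Fact (Name S) V) = f at h
  cases h with
  | main n hn =>
    rcases hn.head_toTemp with ⟨_, e⟩ | ⟨_, e⟩ <;> simp [e] at hf
  | endCont R hR w l hl hf' hnew hq => exact .inr (.inl ⟨_, _, _, hf', hnew, hq⟩)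
  | startCont w hw =>
    obtain ⟨-, rfl, rfl⟩ := Fact.mk.inj hf
    exact .inl hw
  | contInf w x hf' q hq hq0 =>
    obtain ⟨-, rfl, rfl⟩ := Fact.mk.inj hf
    exact .inr (.inr ⟨q, hq, hq0, .inl ⟨x, hf'⟩⟩)
  | keepCont w hf' q hq hq0 =>
    obtain ⟨-, rfl, rfl⟩ := Fact.mk.inj hf
    exact .inr (.inr ⟨q, hq, hq0, .inr hf'⟩)
  | _ => simp at hf

theorem Derives.inf_inv {v : V} {args : List (V ⊕ ℕ)}
    (h : Derives ch κ θ P G I ⟨.inf, v, args⟩) :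
    (∃ w, ⟨.start, w, []⟩ ∈ I) ∨ HasNews I ∨ ∃ w q x, clockFact S w q ∈ I ∧ θ ≤ q ∧
      nodeFact .inf w [x] ∈ I := by
  generalize hf : (⟨.inf, v, args⟩ : Fact (Name S) V) = f at h
  cases h with
  | main n hn =>
    rcases hn.head_toTemp with ⟨_, e⟩ | ⟨_, e⟩ <;> simp [e] at hf
  | endInf R hR w l hl hf' hnew hq => exact .inr (.inl ⟨_, _, _, hf', hnew, hq⟩)
  | startInf w w' hw => exact .inl ⟨w, hw⟩
  | forward w w' x hf' hvw hxw q hq hθ => exact .inr (.inr ⟨w, q, x, hq, hθ, hf'⟩)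
  | _ => simp at hf

end Rewriting

/-! ### The fixpoint of the inflationary computation -/

namespace Datalog

variable {S : Signature.{u}} {V : Type v} {P : Program S} {G : SimpleGraph V}

theorem stage_subset_succ (i : ℕ) : stage P G i ⊆ stage P G (i + 1) := Set.subset_union_right

theorem stage_intensional {i : ℕ} {f : Fact S V} (hf : f ∈ stage P G i) :
    Rewriting.Intensional P f.rel := by
  induction i with
  | zero => exact absurd hf (Set.notMem_empty f)
  | succ i ih =>
    rcases hf with ⟨r, hr, σ, -, rfl⟩ | hf
    · exact ⟨r, hr, rfl⟩
    · exact ih hf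

theorem stage_eq_of_le {m : ℕ} (hm : stage P G (m + 1) = stage P G m) {i : ℕ} (hi : m ≤ i) :
    stage P G i = stage P G m := by
  induction i, hi using Nat.le_induction with
  | base => rfl
  | succ i _ ih =>
    have : stage P G (i + 1) = consequence P G (stage P G i) ∪ stage P G i := rfl
    rw [this, ih]
    exact hm

/-- On a finite graph, the inflationary computation reaches a fixpoint. -/
theorem exists_stage_succ_eq [Finite V] (P : Program S) (G : SimpleGraph V) :
    ∃ m, stage P G (m + 1) = stage P G m := by
  by_contra! h
  have hmono : StrictMono (stage P G) :=
    strictMono_nat_of_lt_succ fun i => (stage_subset_succ i).ssubset_of_ne (h i).symm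
  have hfin : {f : Fact S V | Rewriting.Intensional P f.rel}.Finite := by
    have h1 : (⋃ R ∈ {R | R ∈ P.map Rule.head},
        Set.range fun args : Fin (S.ar R + 1) → V => (⟨R, args⟩ : Fact S V)).Finite :=
      Set.Finite.biUnion (List.finite_toSet _) fun R _ => Set.finite_range _
    refine h1.subset fun f hf => ?_
    obtain ⟨r, hr, he⟩ := hf
    simp only [Set.mem_iUnion]
    exact ⟨f.rel, he ▸ List.mem_map_of_mem hr, f.args, rfl⟩
  refine Set.infinite_range_of_injective hmono.injective (hfin.finite_subsets.subset ?_)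
  rintro _ ⟨i, rfl⟩ f hf
  exact stage_intensional hf

end Datalog

/-! ### The rounds of one stage -/

namespace Rewriting

open Netlog

variable {S : Signature.{u}} {V : Type v} {ch : Choice} {P : Datalog.Program S}
  {G : SimpleGraph V} {D : Set (Datalog.Fact S V)} {I : Set (Fact (Name S) V)} {κ θ : ℕ}

theorem Derives.embed_mem {f : Datalog.Fact S V} (hR : Intensional P f.rel) (hf : embed f ∈ I) :
    Derives ch κ θ P G I (embed f) :=
  .keepBase f.rel hR (f.args 0) (List.ofFn (Fin.tail f.args)) (by simp) hf

/-- Original relations grow only by temporary facts released at clock zero. `hD` is needed because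
persistence rules exist only for intensional relations. -/
theorem Derives.represents (hD : ∀ f ∈ D, Intensional P f.rel) (hI : Represents I D)
    (hnew : ∀ R v args, ⟨.temp R, v, args⟩ ∈ I → clockFact S v 0 ∈ I →
      (⟨.base R, v, args⟩ : Fact (Name S) V) ∈ embed '' D) :
    Represents {f | Derives ch κ θ P G I f} D := by
  intro R v args
  constructor
  · intro h
    rcases h.base_inv with h | ⟨h1, h2⟩
    · exact (hI _ _ _).mp h
    · exact hnew R v args h1 h2
  · rintro ⟨f, hf, he⟩
    rw [← he]
    exact Derives.embed_mem (hD f hf) ((hI.embed_mem f).mpr hf)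

/-- A round of a stage of the computation: all clocks show `q`, nobody has stopped, and the stored
results are correct. -/
structure Running (ch : Choice) (P : Datalog.Program S) (G : SimpleGraph V)
    (D : Set (Datalog.Fact S V)) (q : ℕ) (I : Set (Fact (Name S) V)) : Prop where
  clock : ∀ v args, (⟨.clock, v, args⟩ : Fact (Name S) V) ∈ I ↔ args = [.inr q]
  no_start : ∀ v args, (⟨.start, v, args⟩ : Fact (Name S) V) ∉ I
  no_halt : ∀ v args, (⟨.halt, v, args⟩ : Fact (Name S) V) ∉ I
  base : Represents I D
  sub_sound : SubSound ch P G D I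
  temp_sound : TempSound P G D I

theorem Running.clock_mem {q : ℕ} (h : Running ch P G D q I) (v : V) : clockFact S v q ∈ I :=
  (h.clock v _).mpr rfl

theorem Running.clock_eq {q q' : ℕ} (h : Running ch P G D q I) {v : V}
    (hq : clockFact S v q' ∈ I) : q' = q := by
  simpa using (h.clock v _).mp hq

/-- While the clock is positive, none of the rules for the end of a stage or for halting can fire.
-/
theorem Running.step (hD : ∀ f ∈ D, Intensional P f.rel) {q : ℕ}
    (h : Running ch P G D (q + 1) I) :
    Running ch P G D q {f | Derives ch κ θ P G I f} where
  clock v args := by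
    constructor
    · intro hc
      obtain ⟨q', rfl, ⟨hs, -⟩ | ⟨-, hq | ⟨hq, -⟩⟩⟩ := Derives.clock_inv hc
      · exact absurd hs (h.no_start _ _)
      · rw [Nat.succ.inj (h.clock_eq hq)]
      · exact absurd (h.clock_eq hq) (by omega)
    · rintro rfl
      exact .tick v q (h.clock_mem v) (h.no_halt _ _)
  no_start v args := Derives.not_start
  no_halt v args hh := absurd (h.clock_eq (Derives.halt_inv hh).2.2) (by omega)
  base := Derives.represents hD h.base fun R v args _ hq => absurd (h.clock_eq hq) (by omega)
  sub_sound := Derives.sub_sound h.base h.sub_sound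
  temp_sound := Derives.temp_sound h.base h.sub_sound h.temp_sound

variable {s : ℕ → Set (Fact (Name S) V)}

theorem Running.rounds (hs : ∀ j, s (j + 1) = {f | Derives ch κ θ P G (s j) f})
    (hD : ∀ f ∈ D, Intensional P f.rel) {T : ℕ} (h : Running ch P G D κ (s T)) :
    ∀ t ≤ κ, Running ch P G D (κ - t) (s (T + t)) := by
  intro t
  induction t with
  | zero => exact fun _ => h
  | succ t ih =>
    intro ht
    rw [← Nat.add_assoc, hs]
    refine Running.step hD ?_
    rw [show κ - (t + 1) + 1 = κ - t by omega]
    exact ih (by omega)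

/-! ### Completeness within a stage -/

/-- The results of a sub-query spread along walks. -/
theorem sub_mem_of_walk (hs : ∀ j, s (j + 1) = {f | Derives ch κ θ P G (s j) f}) {T : ℕ}
    (hrun : ∀ t ≤ κ, Running ch P G D (κ - t) (s (T + t))) {n : Node S} (hn : Reach ch P n)
    {c : List (Datalog.Literal S) × ℕ} (hc : c ∈ n.comps) (hna : ¬ n.Adjacent c) {l : List V}
    (hl : l.length = (n.subVars ch c).length) {v w : V} (p : G.Walk v w) : ∀ {t₀ : ℕ},
    (∀ t, t₀ ≤ t → t ≤ κ → nodeFact (.sub (n.sub c)) v l ∈ s (T + t)) →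
    ∀ t, t₀ + p.length ≤ t → t ≤ κ → nodeFact (.sub (n.sub c)) w l ∈ s (T + t) := by
  induction p with
  | nil => exact fun h => h
  | cons hadj p ih =>
    intro t₀ h t ht htκ
    refine ih (t₀ := t₀ + 1) (fun t' ht' htκ' => ?_) t
      (by rw [SimpleGraph.Walk.length_cons] at ht; omega) htκ
    obtain ⟨t', rfl⟩ : ∃ k, t' = k + 1 := ⟨t' - 1, by omega⟩
    rw [← Nat.add_assoc, hs]
    exact .relay n hn c hc hna _ _ l hl (h t' (by omega) (by omega)) hadj _
      ((hrun t' (by omega)).clock_mem _) (by omega)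

theorem holds_child {n : Node S} {c : List (Datalog.Literal S) × ℕ} (hc : c ∈ n.comps)
    {σ : Var → V} (hb : ∀ l ∈ n.body, l.Holds G D σ) :
    ∀ l ∈ (n.child ch c).body, l.Holds G D σ := by
  intro l hl
  rcases mem_subBody.mp hl with hl | ⟨ha, rfl⟩
  · exact hb l (Node.mem_body_of_mem_comps hc hl)
  · obtain ⟨l, hl, he⟩ := adjacent_spec (ch := ch) ha
    have := hb l (List.mem_filter.mp hl).1
    rcases isEdge_spec he with rfl | rfl
    · exact SimpleGraph.Adj.symm this
    · exact this

/-- After the computed number of rounds, the results of a query are complete. -/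
theorem head_mem_of_holds [Finite V] (hG : G.Connected)
    (hs : ∀ j, s (j + 1) = {f | Derives ch κ θ P G (s j) f}) {T : ℕ}
    (hrun : ∀ t ≤ κ, Running ch P G D (κ - t) (s (T + t))) (k : ℕ) :
    ∀ {n : Node S}, (nonlocalPart n.h n.body).length < k → Reach ch P n → ∀ {σ : Var → V},
    (∀ l ∈ n.body, l.Holds G D σ) → ∀ {t : ℕ}, (n.rewritten ch G.diam).2 ≤ t → t ≤ κ →
    ∀ {a : List Var}, n.head.args = a.map .node →
    nodeFact n.head.rel.toTemp (σ n.head.hv) (a.map σ) ∈ s (T + t) := by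
  induction k with
  | zero => exact fun h => absurd h (Nat.not_lt_zero _)
  | succ k ih =>
    intro n hk hn σ hb t ht htκ a ha
    have h1 := one_le_rounds ch G.diam n
    -- The main rule fires in round `t`, where the clock shows `κ - t > 0`, and its head appears one
    -- round later.
    obtain ⟨t, rfl⟩ : ∃ t', t = t' + 1 := ⟨t - 1, by omega⟩
    have hsub : ∀ c ∈ n.comps,
        nodeFact (.sub (n.sub c)) (σ n.h) ((n.subVars ch c).map σ) ∈ s (T + t) := by
      intro c hc
      have hlt := child_measure_lt ch n c hc
      have hle := rounds_child_le ch G.diam n c hc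
      -- Available in every later round and not just the first: the original relations are frozen,
      -- so the rules can fire again each time. This is the form that `sub_mem_of_walk` asks for.
      have hmem : ∀ t', ((n.child ch c).rewritten ch G.diam).2 ≤ t' → t' ≤ κ →
          nodeFact (.sub (n.sub c)) (σ (n.child ch c).head.hv) ((n.subVars ch c).map σ) ∈
            s (T + t') :=
        fun t' h1 h2 => ih (by omega) (hn.child n c hc) (holds_child hc hb) h1 h2 rfl
      by_cases hadj : n.Adjacent c
      · rw [child_head_hv_of_adjacent hadj] at hmem
        rw [transferTime, if_neg hadj] at hle
        exact hmem t (by omega) (by omega)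
      · rw [child_head_hv_of_not_adjacent hadj] at hmem
        rw [transferTime, if_pos (not_not.mp hadj)] at hle
        -- A shortest walk from where the sub-query is evaluated to where it is needed takes at most
        -- the diameter, which is the allowance in `transferTime`.
        obtain ⟨p, hp⟩ := hG.exists_walk_length_eq_dist (σ (n.child ch c).h) (σ n.h)
        have := hG.nonempty
        have hdiam : G.dist (σ (n.child ch c).h) (σ n.h) ≤ G.diam :=
          SimpleGraph.dist_le_diam (SimpleGraph.connected_iff_ediam_ne_top.mp hG)
        exact sub_mem_of_walk hs hrun hn hc hadj (by simp) p hmem t (by omega) (by omega)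
    have hR := hrun t (by omega)
    rw [← Nat.add_assoc, hs]
    have := Derives.main (κ := κ) (θ := θ) n hn σ (fun _ => κ - t)
      (fun l hl => (toNetlog_holds hR.base _ l σ _).mpr (hb l (List.mem_filter.mp hl).1)) hsub
      (hR.clock_mem _) (by omega)
    rwa [ha, map_node_eval] at this

theorem tempFact_mem [Finite V] (hG : G.Connected) (hκ : κ = kappa ch G.diam P)
    (hs : ∀ j, s (j + 1) = {f | Derives ch κ θ P G (s j) f}) {T : ℕ}
    (hrun : ∀ t ≤ κ, Running ch P G D (κ - t) (s (T + t))) {f : Datalog.Fact S V}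
    (hf : f ∈ Datalog.consequence P G D) : tempFact f ∈ s (T + κ) := by
  obtain ⟨r, hr, σ, hb, rfl⟩ := hf
  obtain ⟨i, hi, hri⟩ := List.getElem_of_mem hr
  have hr : (r, i) ∈ P.zipIdx := by
    rw [List.mk_mem_zipIdx_iff_getElem?, ← hri, List.getElem?_eq_getElem hi]
  have := head_mem_of_holds hG hs hrun _ (Nat.lt_succ_self _) (Reach.root r i hr) (σ := σ) hb
    (hκ ▸ rounds_root_le G.diam hr) le_rfl (a := List.ofFn (Fin.tail r.headArgs)) rfl
  rw [nodeFact, List.map_ofFn] at this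
  exact this

/-! ### Propagation of news -/

/-- Some node has news, and its neighbours know about it. -/
def NewsAt (G : SimpleGraph V) (I : Set (Fact (Name S) V)) : Prop :=
  ∃ x, ⟨.cont, x, []⟩ ∈ I ∧ ∀ y, G.Adj x y → nodeFact .inf y [x] ∈ I

/-- No node knows about any news. -/
def NoNews (I : Set (Fact (Name S) V)) : Prop :=
  ∀ v args, (⟨.cont, v, args⟩ : Fact (Name S) V) ∉ I ∧ ⟨.inf, v, args⟩ ∉ I

theorem cont_mem_of_le (hs : ∀ j, s (j + 1) = {f | Derives ch κ θ P G (s j) f}) {T : ℕ}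
    (hrun : ∀ t ≤ κ, Running ch P G D (κ - t) (s (T + t))) {v : V} {t : ℕ}
    (hv : ⟨.cont, v, []⟩ ∈ s (T + t)) (ht : t ≤ κ) : ⟨.cont, v, []⟩ ∈ s (T + κ) := by
  induction ht using Nat.decreasingInduction with
  | self => exact hv
  | of_succ t ht ih =>
    refine ih ?_
    rw [← Nat.add_assoc, hs]
    exact .keepCont v hv _ ((hrun t ht.le).clock_mem v) (by omega)

/-- Within a stage, the news reach all nodes. -/
theorem NewsAt.cont_mem [Finite V] (hG : G.Connected) (hκ : G.diam ≤ κ)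
    (hθ : θ + G.diam ≤ κ + 2) (hs : ∀ j, s (j + 1) = {f | Derives ch κ θ P G (s j) f}) {T : ℕ}
    (hrun : ∀ t ≤ κ, Running ch P G D (κ - t) (s (T + t))) (hnews : NewsAt G (s T)) (v : V) :
    ⟨.cont, v, []⟩ ∈ s (T + κ) := by
  obtain ⟨x, hx, hinf⟩ := hnews
  have := hG.nonempty
  have hdiam : G.dist v x ≤ G.diam :=
    SimpleGraph.dist_le_diam (SimpleGraph.connected_iff_ediam_ne_top.mp hG)
  -- The neighbours are informed at time `T` already, hence the shift by one between distance and
  -- round.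
  have key : ∀ d v, G.dist v x = d + 1 → d + 1 ≤ G.diam → nodeFact .inf v [x] ∈ s (T + d) := by
    intro d
    induction d with
    | zero =>
      intro v hv _
      exact hinf v (SimpleGraph.dist_eq_one_iff_adj.mp hv).symm
    | succ d ih =>
      intro v hv hd
      obtain ⟨p, hp⟩ := hG.exists_walk_length_eq_dist v x
      cases p with
      | nil => simp at hv
      | cons hadj p =>
        rename_i u
        rw [SimpleGraph.Walk.length_cons] at hp
        have h1 := SimpleGraph.dist_le p
        have h2 := hG.dist_triangle (u := v) (v := u) (w := x)
        rw [SimpleGraph.dist_eq_one_iff_adj.mpr hadj] at h2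
        rw [← Nat.add_assoc, hs]
        -- The bound on `θ` comes from here: the clock shows `κ - d`, and `d + 2 ≤ G.diam` because
        -- `v` lies at distance `d + 2`, so `θ ≤ κ - G.diam + 2` suffices.
        refine .forward u v x (ih u (by omega) (by omega)) hadj.symm ?_ _
          ((hrun d (by omega)).clock_mem u) (by omega)
        rintro rfl
        simp at hv
  rcases Nat.eq_zero_or_pos (G.dist v x) with h0 | hpos
  · rw [hG.dist_eq_zero_iff] at h0
    exact cont_mem_of_le hs hrun (t := 0) (h0 ▸ hx) (Nat.zero_le _)
  · obtain ⟨d, hd⟩ : ∃ d, G.dist v x = d + 1 := ⟨G.dist v x - 1, by omega⟩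
    refine cont_mem_of_le hs hrun (t := d + 1) ?_ (by omega)
    rw [← Nat.add_assoc, hs]
    exact .contInf v x (key d v hd (by omega)) _ ((hrun d (by omega)).clock_mem v) (by omega)

theorem mk_temp_eq_tempFact {R : S.Rel} {v : V} {args : List (V ⊕ ℕ)} {f : Datalog.Fact S V}
    (h : (⟨.temp R, v, args⟩ : Fact (Name S) V) = tempFact f) :
    (⟨.base R, v, args⟩ : Fact (Name S) V) = embed f := by
  simp only [tempFact, Fact.mk.injEq, Name.temp.injEq] at h
  obtain ⟨rfl, rfl, rfl⟩ := h
  rfl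

/-- News need clock zero and a temporary fact outside `D`; temporary facts are consequences of `D`,
so a closed `D` leaves none. -/
theorem Running.not_hasNews {q : ℕ} (h : Running ch P G D q I)
    (hq : q ≠ 0 ∨ Datalog.consequence P G D ⊆ D) : ¬ HasNews I := by
  rintro ⟨R, v, args, h1, h2, h3⟩
  rcases hq with hq | hq
  · exact hq (h.clock_eq h3).symm
  · obtain ⟨f, hf, he⟩ := h.temp_sound _ _ _ h1
    exact h2 ((h.base _ _ _).mpr ⟨f, hq hf, (mk_temp_eq_tempFact he).symm⟩)

theorem NoNews.step (hstart : ∀ v args, (⟨.start, v, args⟩ : Fact (Name S) V) ∉ I)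
    (hnews : ¬ HasNews I) (h : NoNews I) : NoNews {f | Derives ch κ θ P G I f} := by
  refine fun v args => ⟨fun hc => ?_, fun hi => ?_⟩
  · rcases Derives.cont_inv hc with hc | hc | ⟨q, -, -, ⟨x, hx⟩ | hx⟩
    exacts [hstart _ _ hc, hnews hc, (h _ _).2 hx, (h _ _).1 hx]
  · rcases Derives.inf_inv hi with ⟨w, hi⟩ | hi | ⟨w, q, x, -, -, hx⟩
    exacts [hstart _ _ hi, hnews hi, (h _ _).2 hx]

theorem NoNews.rounds (hs : ∀ j, s (j + 1) = {f | Derives ch κ θ P G (s j) f}) {T : ℕ}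
    (hrun : ∀ t ≤ κ, Running ch P G D (κ - t) (s (T + t))) (h : NoNews (s T)) :
    ∀ t ≤ κ, NoNews (s (T + t)) := by
  intro t
  induction t with
  | zero => exact fun _ => h
  | succ t ih =>
    intro ht
    rw [← Nat.add_assoc, hs]
    have hR := hrun t (by omega)
    exact NoNews.step hR.no_start (hR.not_hasNews (.inl (by omega))) (ih (by omega))

/-! ### Resets and halting -/

/-- The rounds in which the clocks are reset. -/
structure Reset (D : Set (Datalog.Fact S V)) (κ : ℕ) (I : Set (Fact (Name S) V)) : Prop where
  clock : ∀ v args, (⟨.clock, v, args⟩ : Fact (Name S) V) ∈ I ↔ args = [.inr κ]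
  no_start : ∀ v args, (⟨.start, v, args⟩ : Fact (Name S) V) ∉ I
  no_sub : ∀ p v args, (⟨.sub p, v, args⟩ : Fact (Name S) V) ∉ I
  no_temp : ∀ R v args, (⟨.temp R, v, args⟩ : Fact (Name S) V) ∉ I
  base : Represents I D

/-- With no sub-query or temporary facts left over, soundness starts out vacuously true. The absence
of `halt` is a separate hypothesis since the final reset happens just as all nodes halt. -/
theorem Reset.running (h : Reset D κ I)
    (hh : ∀ v args, (⟨.halt, v, args⟩ : Fact (Name S) V) ∉ I) : Running ch P G D κ I where
  clock := h.clock
  no_start := h.no_start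
  no_halt := hh
  base := h.base
  sub_sound p w args hf := absurd hf (h.no_sub p w args)
  temp_sound R w args hf := absurd hf (h.no_temp R w args)

theorem Running.reset (hD : ∀ f ∈ D, Intensional P f.rel) (h : Running ch P G D 0 I)
    (htemp : ∀ f ∈ Datalog.consequence P G D, tempFact f ∈ I) :
    Reset (Datalog.consequence P G D ∪ D) κ {f | Derives ch κ θ P G I f} where
  clock v args := by
    constructor
    · intro hc
      obtain ⟨q', rfl, ⟨hs, -⟩ | ⟨-, hq | ⟨-, hq⟩⟩⟩ := Derives.clock_inv hc
      · exact absurd hs (h.no_start _ _)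
      · exact absurd (h.clock_eq hq) (by omega)
      · rw [hq]
    · rintro rfl
      exact .reset v (h.clock_mem v) (h.no_halt _ _)
  no_start v args := Derives.not_start
  no_sub p v args hf := by
    obtain ⟨w, q, hq, hq0⟩ := Derives.sub_inv hf
    exact hq0 (h.clock_eq hq)
  no_temp R v args hf := by
    obtain ⟨w, q, hq, hq0⟩ := Derives.temp_inv hf
    exact hq0 (h.clock_eq hq)
  base R v args := by
    constructor
    · intro hf
      rcases Derives.base_inv hf with hf | ⟨hf, -⟩
      · exact Set.image_mono Set.subset_union_right ((h.base _ _ _).mp hf)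
      · obtain ⟨f, hf, he⟩ := h.temp_sound _ _ _ hf
        exact ⟨f, .inl hf, (mk_temp_eq_tempFact he).symm⟩
    · rintro ⟨f, hf | hf, he⟩
      · rw [← he]
        have hR : Intensional P f.rel := by
          obtain ⟨r, hr, σ, -, rfl⟩ := hf
          exact ⟨r, hr, rfl⟩
        exact .endBase f.rel hR (f.args 0) (List.ofFn (Fin.tail f.args)) (by simp) (htemp f hf)
          (h.clock_mem _)
      · rw [← he]
        exact Derives.embed_mem (hD f hf) ((h.base.embed_mem f).mpr hf)

theorem Running.newsAt (h : Running ch P G D 0 I)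
    (htemp : ∀ f ∈ Datalog.consequence P G D, tempFact f ∈ I)
    (hnew : ¬ Datalog.consequence P G D ⊆ D) : NewsAt G {f | Derives ch κ θ P G I f} := by
  obtain ⟨f, hf, hfD⟩ := Set.not_subset.mp hnew
  have hR : Intensional P f.rel := by
    obtain ⟨r, hr, σ, -, rfl⟩ := hf
    exact ⟨r, hr, rfl⟩
  have hbase : embed f ∉ I := fun h' => hfD ((h.base.embed_mem f).mp h')
  refine ⟨f.args 0, ?_, fun y hy => ?_⟩
  · exact .endCont f.rel hR (f.args 0) (List.ofFn (Fin.tail f.args)) (by simp) (htemp f hf) hbase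
      (h.clock_mem _)
  · exact .endInf f.rel hR (f.args 0) (List.ofFn (Fin.tail f.args)) (by simp) (htemp f hf) hbase
      (h.clock_mem _) y hy

/-- At clock zero `1 ≤ θ` blocks forwarding, and neither `inf` nor `cont` is kept, so messages still
under way are lost and cannot enter the next stage. -/
theorem Running.noNews (hθ : 1 ≤ θ) (h : Running ch P G D 0 I)
    (hnew : Datalog.consequence P G D ⊆ D) :
    NoNews {f | Derives ch κ θ P G I f} := by
  have hnn := h.not_hasNews (.inr hnew)
  refine fun v args => ⟨fun hc => ?_, fun hi => ?_⟩
  · rcases Derives.cont_inv hc with hc | hc | ⟨q, hq, hq0, -⟩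
    exacts [h.no_start _ _ hc, hnn hc, hq0 (h.clock_eq hq)]
  · rcases Derives.inf_inv hi with ⟨w, hi⟩ | hi | ⟨w, q, x, hq, hq0, -⟩
    · exact h.no_start _ _ hi
    · exact hnn hi
    · have := h.clock_eq hq
      omega

/-- The rounds after all nodes have stopped. -/
structure Halted (D : Set (Datalog.Fact S V)) (I : Set (Fact (Name S) V)) : Prop where
  no_clock : ∀ v args, (⟨.clock, v, args⟩ : Fact (Name S) V) ∉ I
  no_start : ∀ v args, (⟨.start, v, args⟩ : Fact (Name S) V) ∉ I
  noNews : NoNews I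
  base : Represents I D

theorem Halted.step (hD : ∀ f ∈ D, Intensional P f.rel) (h : Halted D I) :
    Halted D {f | Derives ch κ θ P G I f} where
  no_clock v args hf := by
    obtain ⟨q, -, ⟨hq, -⟩ | ⟨-, hq | ⟨hq, -⟩⟩⟩ := Derives.clock_inv hf
    exacts [h.no_start _ _ hq, h.no_clock _ _ hq, h.no_clock _ _ hq]
  no_start v args := Derives.not_start
  noNews := h.noNews.step h.no_start fun ⟨_, _, _, _, _, hq⟩ => h.no_clock _ _ hq
  base := Derives.represents hD h.base fun _ _ _ _ hq => absurd hq (h.no_clock _ _)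

/-- A halted instance may still hold leftover temporary, sub-query or `halt` facts; deriving any of
these needs a clock, so one further round removes them. -/
theorem Halted.derives_eq (hD : ∀ f ∈ D, Intensional P f.rel) (h : Halted D I) :
    {f | Derives ch κ θ P G I f} = embed '' D := by
  have h' : Halted D {f | Derives ch κ θ P G I f} := h.step hD
  refine Set.Subset.antisymm ?_ ?_
  · rintro ⟨R, v, args⟩ hf
    cases R with
    | base R => exact (h'.base _ _ _).mp hf
    | temp R =>
      obtain ⟨w, q, hq, -⟩ := Derives.temp_inv hf
      exact absurd hq (h.no_clock _ _)
    | sub p =>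
      obtain ⟨w, q, hq, -⟩ := Derives.sub_inv hf
      exact absurd hq (h.no_clock _ _)
    | start => exact absurd hf (h'.no_start _ _)
    | clock => exact absurd hf (h'.no_clock _ _)
    | cont => exact absurd hf (h'.noNews _ _).1
    | inf => exact absurd hf (h'.noNews _ _).2
    | halt => exact absurd (Derives.halt_inv hf).2.2 (h.no_clock _ _)
  · rintro _ ⟨f, hf, rfl⟩
    exact (h'.base.embed_mem f).mpr hf

theorem Reset.halted (hD : ∀ f ∈ D, Intensional P f.rel) (h : Reset D κ I) (hn : NoNews I)
    (hh : ∀ v, ⟨.halt, v, []⟩ ∈ I) : Halted D {f | Derives ch κ θ P G I f} where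
  no_clock v args hf := by
    obtain ⟨q, -, ⟨hq, -⟩ | ⟨hq, -⟩⟩ := Derives.clock_inv hf
    exacts [h.no_start _ _ hq, hq (hh v)]
  no_start v args := Derives.not_start
  noNews := hn.step h.no_start fun ⟨_, _, _, hf, _, _⟩ => h.no_temp _ _ _ hf
  base := Derives.represents hD h.base fun _ _ _ hf _ => absurd hf (h.no_temp _ _ _)

theorem reset_one (hs0 : s 0 = startInstance S V)
    (hs : ∀ j, s (j + 1) = {f | Derives ch κ θ P G (s j) f}) : Reset ∅ κ (s 1) := by
  have hclock : ∀ v q, clockFact S v q ∉ s 0 := by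
    rintro v q h
    rw [hs0] at h
    obtain ⟨w, hw⟩ := h
    simp at hw
  rw [show (1 : ℕ) = 0 + 1 from rfl, hs]
  refine ⟨fun v args => ⟨fun h => ?_, ?_⟩, fun v args => Derives.not_start, fun p v args h => ?_,
    fun R v args h => ?_, fun R v args => ⟨fun h => ?_, fun h => ?_⟩⟩
  · obtain ⟨q, rfl, ⟨-, rfl⟩ | ⟨-, hq | ⟨hq, -⟩⟩⟩ := Derives.clock_inv h
    · rfl
    · exact absurd hq (hclock _ _)
    · exact absurd hq (hclock _ _)
  · rintro rfl
    exact .startClock v (hs0 ▸ ⟨v, rfl⟩)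
  · obtain ⟨w, q, hq, -⟩ := Derives.sub_inv h
    exact hclock _ _ hq
  · obtain ⟨w, q, hq, -⟩ := Derives.temp_inv h
    exact hclock _ _ hq
  · rcases Derives.base_inv h with h | ⟨-, h⟩
    · rw [hs0] at h
      obtain ⟨w, hw⟩ := h
      simp at hw
    · exact absurd h (hclock _ _)
  · simp at h

theorem no_halt_one (hs0 : s 0 = startInstance S V)
    (hs : ∀ j, s (j + 1) = {f | Derives ch κ θ P G (s j) f}) (v : V) (args : List (V ⊕ ℕ)) :
    ⟨.halt, v, args⟩ ∉ s 1 := by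
  rw [show (1 : ℕ) = 0 + 1 from rfl, hs]
  intro h
  have := (Derives.halt_inv h).2.2
  rw [hs0] at this
  obtain ⟨w, hw⟩ := this
  simp at hw

/-- The start rules act as news, so the first stage is never cut short, even for a program that
derives nothing. -/
theorem newsAt_one (hG : G.Connected) (hs0 : s 0 = startInstance S V)
    (hs : ∀ j, s (j + 1) = {f | Derives ch κ θ P G (s j) f}) : NewsAt G (s 1) := by
  obtain ⟨x⟩ := hG.nonempty
  have hx : (⟨.start, x, []⟩ : Fact (Name S) V) ∈ s 0 := hs0 ▸ ⟨x, rfl⟩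
  rw [show (1 : ℕ) = 0 + 1 from rfl, hs]
  exact ⟨x, .startCont x hx, fun y hy => .startInf x y hx hy⟩

/-! ### The course of the whole computation -/

theorem stage_time (i κ : ℕ) : (i + 1) * (κ + 1) + 1 = i * (κ + 1) + 1 + κ + 1 := by ring

/-- Before the fixpoint is reached, the nodes run the stages in lockstep, with news in each. -/
theorem running_of_le [Finite V] (hG : G.Connected) (hκ : κ = kappa ch G.diam P)
    (hθκ : θ + G.diam ≤ κ + 2) (hs0 : s 0 = startInstance S V)
    (hs : ∀ j, s (j + 1) = {f | Derives ch κ θ P G (s j) f}) {m : ℕ}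
    (hm : ∀ i < m, Datalog.stage P G (i + 1) ≠ Datalog.stage P G i) {i : ℕ} (hi : i ≤ m) :
    Running ch P G (Datalog.stage P G i) κ (s (i * (κ + 1) + 1)) ∧
      NewsAt G (s (i * (κ + 1) + 1)) := by
  have hκ' : G.diam ≤ κ := hκ ▸ le_max_left _ _
  induction i with
  | zero =>
    rw [Nat.zero_mul, Nat.zero_add]
    exact ⟨(reset_one hs0 hs).running (no_halt_one hs0 hs), newsAt_one hG hs0 hs⟩
  | succ i ih =>
    obtain ⟨hR, hN⟩ := ih (by omega)
    have hD : ∀ f ∈ Datalog.stage P G i, Intensional P f.rel :=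
      fun f hf => Datalog.stage_intensional hf
    have hrun := hR.rounds hs hD
    have htemp := fun f => tempFact_mem (f := f) hG hκ hs hrun
    have hlast := hrun κ le_rfl
    rw [Nat.sub_self] at hlast
    rw [stage_time, hs]
    refine ⟨(hlast.reset hD htemp).running fun v args hh => ?_, ?_⟩
    -- The news from the start of this stage have made every node continue by clock zero.
    · exact (Derives.halt_inv hh).2.1 (hN.cont_mem hG hκ' hθκ hs hrun v)
    · exact hlast.newsAt htemp fun h => hm i (by omega) (Set.union_eq_right.mpr h)

/-- The course of the computation after the fixpoint `D` is reached. -/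
theorem eventually_halted [Finite V] (hG : G.Connected) (hκ : κ = kappa ch G.diam P)
    (hθ : 1 ≤ θ) (hθκ : θ + G.diam ≤ κ + 2)
    (hs : ∀ j, s (j + 1) = {f | Derives ch κ θ P G (s j) f}) {T : ℕ}
    (hD : ∀ f ∈ D, Intensional P f.rel) (hfix : Datalog.consequence P G D ⊆ D)
    (hR : Running ch P G D κ (s T)) (hN : NewsAt G (s T)) :
    (∀ j, Represents (s (T + j)) D) ∧ ∃ j₀, ∀ j ≥ j₀, s j = embed '' D := by
  -- First idle stage: nothing new is found, but news from its beginning prevent halting at its end.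
  have hrun₁ := hR.rounds hs hD
  have hlast₁ := hrun₁ κ le_rfl
  rw [Nat.sub_self] at hlast₁
  have hreset₁ : Reset D κ (s (T + κ + 1)) := by
    rw [hs]
    have := hlast₁.reset (κ := κ) (θ := θ) hD fun f => tempFact_mem (f := f) hG hκ hs hrun₁
    rwa [Set.union_eq_right.mpr hfix] at this
  -- Second idle stage: it begins without news, so no node continues at its end.
  have hrun₂ : ∀ t ≤ κ, Running ch P G D (κ - t) (s (T + κ + 1 + t)) := by
    refine (hreset₁.running fun v args hh => ?_).rounds hs hD
    rw [hs] at hh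
    exact (Derives.halt_inv hh).2.1
      (hN.cont_mem hG (hκ ▸ le_max_left _ _) hθκ hs hrun₁ v)
  have hquiet : ∀ t ≤ κ, NoNews (s (T + κ + 1 + t)) := by
    refine NoNews.rounds hs hrun₂ ?_
    rw [hs]
    exact hlast₁.noNews hθ hfix
  have hlast₂ := hrun₂ κ le_rfl
  rw [Nat.sub_self] at hlast₂
  have hreset₂ : Reset D κ (s (T + κ + 1 + κ + 1)) := by
    rw [hs]
    have := hlast₂.reset (κ := κ) (θ := θ) hD fun f => tempFact_mem (f := f) hG hκ hs hrun₂
    rwa [Set.union_eq_right.mpr hfix] at this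
  -- The reset and halting rules fire in the same round, so the clocks show `κ` once more beside
  -- `halt`; they vanish only one round later.
  have hhalted : ∀ j, Halted D (s (T + κ + 1 + κ + 1 + 1 + j)) := by
    intro j
    induction j with
    | zero =>
      rw [Nat.add_zero, hs]
      refine hreset₂.halted hD ?_ fun v => ?_
      · rw [hs]
        exact hlast₂.noNews hθ hfix
      · rw [hs]
        exact .halt v (hquiet κ le_rfl v _).1 (hlast₂.clock_mem v)
    | succ j ih =>
      rw [← Nat.add_assoc, hs]
      exact ih.step hD
  -- The last `+ 1` is the round that clears what was derived while the clocks were last present.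
  refine ⟨fun j => ?_, T + κ + 1 + κ + 1 + 1 + 1, fun j hj => ?_⟩
  · by_cases h1 : j ≤ κ
    · exact (hrun₁ j h1).base
    by_cases h2 : j ≤ κ + 1 + κ
    · have := (hrun₂ (j - (κ + 1)) (by omega)).base
      rwa [show T + κ + 1 + (j - (κ + 1)) = T + j by omega] at this
    by_cases h3 : j = κ + 1 + κ + 1
    · have := hreset₂.base
      rwa [show T + κ + 1 + κ + 1 = T + j by omega] at this
    · have := (hhalted (j - (κ + 1 + κ + 1 + 1))).base
      rwa [show T + κ + 1 + κ + 1 + 1 + (j - (κ + 1 + κ + 1 + 1)) = T + j by omega] at this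
  · have := (hhalted (j - (T + κ + 1 + κ + 1 + 1 + 1))).derives_eq (ch := ch) (κ := κ) (θ := θ)
      (G := G) hD
    rw [← hs] at this
    rwa [show T + κ + 1 + κ + 1 + 1 + (j - (T + κ + 1 + κ + 1 + 1 + 1)) + 1 = j by omega] at this

end Rewriting

/-! ### The theorem -/

theorem ConvergesTo.unique {α : Type*} {s : ℕ → Set α} {I J : Set α} (hI : ConvergesTo s I)
    (hJ : ConvergesTo s J) : I = J := by
  obtain ⟨n, hn⟩ := hI
  obtain ⟨m, hm⟩ := hJ
  rw [← hn (max n m) (le_max_left _ _), hm (max n m) (le_max_right _ _)]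

theorem theorem6 {S : Signature.{u}} {V : Type v} [Finite V] (G : SimpleGraph V)
    (hG : G.Connected) (P : Datalog.Program S) (ch : Rewriting.Choice) (κ θ : ℕ)
    (hκ : κ = Rewriting.kappa ch G.diam P) (hθ : 1 ≤ θ) (hθκ : θ + G.diam ≤ κ + 2)
    (N : Netlog.Program (Rewriting.Name S)) (hN : N = Rewriting.netlogProgram ch G.diam θ P) :
    (∀ r ∈ N, r.Localized) ∧
    (Terminates (Netlog.stage N G (Rewriting.startInstance S V)) ↔
      Terminates (Datalog.stage P G)) ∧
    (∀ (I : Set (Datalog.Fact S V)) (J : Set (Netlog.Fact (Rewriting.Name S) V)),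
      ConvergesTo (Datalog.stage P G) I →
      ConvergesTo (Netlog.stage N G (Rewriting.startInstance S V)) J →
      J = Rewriting.embed '' I) ∧
    (∀ (i : ℕ) (f : Datalog.Fact S V),
      f ∈ Datalog.stage P G i ↔
        Rewriting.embed f ∈
          Netlog.stage N G (Rewriting.startInstance S V) (i * (κ + 1) + 1)) := by
  classical
  subst hN
  refine ⟨fun r hr => Rewriting.localized_netlogProgram hr, ?_⟩
  set s := Netlog.stage (Rewriting.netlogProgram ch G.diam θ P) G (Rewriting.startInstance S V)
  have hs0 : s 0 = Rewriting.startInstance S V := rfl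
  have hs : ∀ j, s (j + 1) = {f | Rewriting.Derives ch κ θ P G (s j) f} := by
    intro j
    rw [hκ]
    exact Set.ext fun f =>
      ⟨Rewriting.derives_of_mem_consequence, Rewriting.mem_consequence_of_derives⟩
  have hex := Datalog.exists_stage_succ_eq P G
  -- Minimality of `m` supplies the news in every earlier stage.
  obtain ⟨m, hfix, hm⟩ : ∃ m, Datalog.stage P G (m + 1) = Datalog.stage P G m ∧
      ∀ i < m, Datalog.stage P G (i + 1) ≠ Datalog.stage P G i :=
    ⟨Nat.find hex, Nat.find_spec hex, fun i hi => Nat.find_min hex hi⟩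
  have hstable : ∀ i, m ≤ i → Datalog.stage P G i = Datalog.stage P G m :=
    fun i hi => Datalog.stage_eq_of_le hfix hi
  have hrun := fun i (hi : i ≤ m) =>
    Rewriting.running_of_le hG hκ hθκ hs0 hs hm hi
  obtain ⟨hR, hNews⟩ := hrun m le_rfl
  obtain ⟨hrep, j₀, hj₀⟩ := Rewriting.eventually_halted hG hκ hθ hθκ hs
    (fun f hf => Datalog.stage_intensional hf) (Set.union_eq_right.mp hfix) hR hNews
  have hDL : ConvergesTo (Datalog.stage P G) (Datalog.stage P G m) := ⟨m, hstable⟩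
  have hNL : ConvergesTo s (Rewriting.embed '' Datalog.stage P G m) := ⟨j₀, hj₀⟩
  refine ⟨⟨fun _ => ⟨_, hDL⟩, fun _ => ⟨_, hNL⟩⟩, fun I J hI hJ => ?_, fun i f => ?_⟩
  · rw [hI.unique hDL, hJ.unique hNL]
  · rcases le_total i m with hi | hi
    · exact ((hrun i hi).1.base.embed_mem f).symm
    -- Beyond the fixpoint the sampled times are offsets from the beginning of stage `m`, and `hrep`
    -- covers all of these, before and after halting.
    · obtain ⟨k, rfl⟩ := Nat.exists_eq_add_of_le hi
      rw [hstable _ hi, show (m + k) * (κ + 1) + 1 = m * (κ + 1) + 1 + k * (κ + 1) by ring]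
      exact ((hrep _).embed_mem f).symm
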